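/- Let $K$ be a perfect field, $P=K[X_0,\dots,X_n]$, and let $\mathbb X$ be a $0$-dimensional closed subscheme of $\mathbb P^n_K$, with (saturated homogeneous) vanishing ideal $I_{\mathbb X}\subseteq P$ and homogeneous coordinate ring $R=P/I_{\mathbb X}$, a ring of Krull dimension $1$. Assume that the residue class $x_0\in R$ of $X_0$ is a non-zerodivisor (i.e. no point of $\mathbb X$ lies on the hyperplane $X_0=0$), and let $S=R/\langle x_0-1\rangle$ be the affine coordinate ring of $\mathbb X$. Let $\mathcal O_1,\dots,\mathcal O_t$ be the local rings of $\mathbb X$, i.e. the localizations of $S$ at its (finitely many) maximal ideals, so that $S\cong\mathcal O_1\times\cdots\times\mathcal O_t$. Let $L_i$ be the residue class field of $\mathcal O_i$, let $\kappa_i=\dim_K(L_i)$ and $\nu_i=\dim_K(\mathcal O_i)/\kappa_i$. Assume that $\mathbb X$ is weakly curvilinear, i.e. that the maximal ideal of each $\mathcal O_i$ is generated by one element. For $m\ge 1$ let $\Omega^m_{R/K}=\bigwedge^m_R\Omega^1_{R/K}$ be the graded $R$-module of Kähler differential $m$-forms, where $dg$ has degree $b$ for $g\in R$ homogeneous of degree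 $b$. For a finitely generated graded $R$-module $M$ let $\mathrm{HP}(M)$ denote the value of its constant Hilbert polynomial, i.e. $\mathrm{HP}(M)=\dim_K(M_i)$ for all $i\gg 0$, and let $\deg(\mathbb X)=\mathrm{HP}(R)$. Then these Hilbert polynomials exist, and: (a) $\displaystyle \mathrm{HP}(\Omega^1_{R/K}) = 2\deg(\mathbb X)-\sum_{\operatorname{char}(K)\,\nmid\,\nu_i}\kappa_i$. (b) $\displaystyle \mathrm{HP}(\Omega^2_{R/K}) = \deg(\mathbb X)-\sum_{\operatorname{char}(K)\,\nmid\,\nu_i}\kappa_i$. (c) $\mathrm{HP}(\Omega^m_{R/K})=0$ for all $m>2$. (If $\operatorname{char}(K)=0$, the condition $\operatorname{char}(K)\nmid\nu_i$ holds for all $i$.) -/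

import Mathlib

open Filter

noncomputable section

/-- A zero-dimensional closed subscheme of projective `n`-space over `K`, given by its homogeneous
vanishing ideal in `K[X_0, …, X_n]`: a saturated homogeneous ideal whose residue class ring has
Krull dimension one. -/
structure ZeroDimScheme (K : Type*) [Field K] (n : ℕ) where
  /-- the homogeneous vanishing ideal -/
  ideal : Ideal (MvPolynomial (Fin (n + 1)) K)
  homogeneous : ∀ f ∈ ideal, ∀ i, MvPolynomial.homogeneousComponent i f ∈ ideal
  saturated : ∀ f, (∀ j, MvPolynomial.X j * f ∈ ideal) → f ∈ ideal
  dimension : ringKrullDim (MvPolynomial (Fin (n + 1)) K ⧸ ideal) = 1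

namespace ZeroDimScheme

variable {K : Type*} [Field K] {n : ℕ} (X : ZeroDimScheme K n)

/-- The homogeneous coordinate ring `R = K[X_0, …, X_n] / I`. -/
def R : Type _ := MvPolynomial (Fin (n + 1)) K ⧸ X.ideal

instance : CommRing X.R := inferInstanceAs (CommRing (MvPolynomial (Fin (n + 1)) K ⧸ X.ideal))

instance : Algebra K X.R := inferInstanceAs (Algebra K (MvPolynomial (Fin (n + 1)) K ⧸ X.ideal))

/-- The residue class homomorphism `K[X_0, …, X_n] → R`. -/
def toR : MvPolynomial (Fin (n + 1)) K →ₐ[K] X.R := Ideal.Quotient.mkₐ K X.ideal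

/-- The residue class `x_j` of the indeterminate `X_j` in `R`. -/
def x (j : Fin (n + 1)) : X.R := X.toR (MvPolynomial.X j)

/-- The homogeneous component `R_i`. -/
def component (i : ℕ) : Submodule K X.R :=
  (MvPolynomial.homogeneousSubmodule (Fin (n + 1)) K i).map X.toR.toLinearMap

/-- The Hilbert function `i ↦ dim_K R_i`. -/
def hilbertFunction (i : ℕ) : ℕ := Module.finrank K (X.component i)

/-- The module `Ω^m_{R/K}` of Kähler differential `m`-forms: the `m`-th exterior power over `R`
of the module of Kähler differentials of `R/K`. -/
abbrev Omega (m : ℕ) : Type _ := ⋀[X.R]^m (Ω[X.R⁄K])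

/-- The homogeneous component `(Ω^m_{R/K})_i` of the natural grading, in which the differential of
a homogeneous element of degree `b` is homogeneous of degree `b`: it is the `K`-span of the forms
`f • dg_1 ∧ … ∧ dg_m` with `f, g_1, …, g_m` homogeneous in `R` and
`deg f + deg g_1 + ⋯ + deg g_m = i`. -/
def omegaComponent (m i : ℕ) : Submodule K (X.Omega m) :=
  Submodule.span K {w | ∃ (a : ℕ) (b : Fin m → ℕ) (f : X.R) (g : Fin m → X.R),
    f ∈ X.component a ∧ (∀ k, g k ∈ X.component (b k)) ∧ a + ∑ k, b k = i ∧
    w = f • exteriorPower.ιMulti X.R m (fun k => KaehlerDifferential.D K X.R (g k))}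

/-- The Hilbert function `i ↦ dim_K (Ω^m_{R/K})_i`. It vanishes in negative degrees, so it is
recorded on `ℕ`. -/
def omegaHilbertFunction (m i : ℕ) : ℕ := Module.finrank K (X.omegaComponent m i)

/-- The affine coordinate ring `S = R / ⟨x_0 - 1⟩` of the part of the scheme in `D_+(X_0)`. -/
def S : Type _ := X.R ⧸ Ideal.span {X.x 0 - 1}

instance : CommRing X.S := inferInstanceAs (CommRing (X.R ⧸ Ideal.span {X.x 0 - 1}))

instance : Algebra K X.S := inferInstanceAs (Algebra K (X.R ⧸ Ideal.span {X.x 0 - 1}))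

/-- The local ring of the scheme at the point given by the maximal ideal `p` of `S`. -/
abbrev localRing (p : MaximalSpectrum X.S) : Type _ := Localization.AtPrime p.asIdeal

/-- The scheme is weakly curvilinear if the maximal ideals of all its local rings are generated
by one element. (To be used if no point of the scheme lies on the hyperplane `X_0 = 0`, so that
all its points are given by maximal ideals of `S`.) -/
def IsWeaklyCurvilinear : Prop :=
  ∀ p : MaximalSpectrum X.S, (IsLocalRing.maximalIdeal (X.localRing p)).IsPrincipal

/-- `κ`, the `K`-dimension of the residue class field of the local ring at `p`. -/
def residueDegree (p : MaximalSpectrum X.S) : ℕ :=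
  Module.finrank K (IsLocalRing.ResidueField (X.localRing p))

/-- `ν = dim_K(𝒪) / κ` for the local ring `𝒪` at `p`. (The division is exact.) -/
def localLength (p : MaximalSpectrum X.S) : ℕ :=
  Module.finrank K (X.localRing p) / X.residueDegree p

end ZeroDimScheme

/-- The Hilbert function `h` has constant Hilbert polynomial `c`, i.e. `h i = c` for `i ≫ 0`. -/
def HasHilbertPolynomial (h : ℕ → ℕ) (c : ℤ) : Prop := ∀ᶠ i in atTop, (h i : ℤ) = c

open Classical in
/-- The degree of the scheme: the value of the constant Hilbert polynomial of `R`. -/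
def ZeroDimScheme.degree {K : Type*} [Field K] {n : ℕ} (X : ZeroDimScheme K n) : ℤ :=
  if h : ∃ c : ℤ, HasHilbertPolynomial X.hilbertFunction c then h.choose else 0

end

/-! Inverting `x_0` turns `R` into Laurent polynomials in `x_0` over `S`. There the 1-forms split
into multiples of `dx_0` and forms coming from `S`, so in large degrees `Ω^1_R` should have
dimension `dim S + dim Ω_S`. If `Ω_S` is cyclic, `Ω^2_R` should have dimension `dim Ω_S` and higher
forms should vanish. It remains to compute `dim Ω_S`.

Local part: since `K` is perfect, each local ring `O` contains its residue field `L` over `K`, and a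
generator `z` of the maximal ideal gives `O ≅ L[z]/(z^ν)`. As `L/K` is étale, `Ω_{O/K} = Ω_{O/L}` is
generated by `dz` with the single relation `ν z^(ν-1) dz = 0`. This relation costs `κ` dimensions
when `char K ∤ ν` and nothing otherwise. Multiplying over the points makes `Ω_S` cyclic of dimension
`dim S - ∑ κ_i` (`kaehlerDifferential_of_isPrincipal_maximalIdeal`).

Graded part: the dimensions of the forms on `R` are squeezed. Lower bounds come from the Euler
derivation, which supplies maps from `Ω^1_R` to `S × Ω_S` and from `Ω^2_R` to `Ω_S` that are onto
already in each large degree. Upper bounds come from `exists_lift_generator`: up to powers of `x_0`,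
every `dg` combines `dx_0` and one further form `v`. Those powers are harmless because in large
degrees every homogeneous form is divisible by `x_0` (`eventually_omegaComponent_succ_le`). -/

/-- A derivation that annihilates the kernel of a surjection of algebras descends to the target. -/
theorem Derivation.exists_descend {k A B M : Type*} [CommRing k] [CommRing A] [CommRing B]
    [Algebra k A] [Algebra k B] [Algebra A B] [IsScalarTower k A B] [AddCommGroup M] [Module k M]
    [Module A M] [Module B M] [IsScalarTower A B M]
    (hAB : Function.Surjective (algebraMap A B)) (d : Derivation k A M)
    (hd : ∀ a, algebraMap A B a = 0 → d a = 0) :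
    ∃ d' : Derivation k B M, ∀ a, d' (algebraMap A B a) = d a := by
  have key : ∀ a a', algebraMap A B a = algebraMap A B a' → d a = d a' := fun a a' h => by
    rw [← sub_eq_zero, ← map_sub]
    exact hd _ (by rw [map_sub, h, sub_self])
  let s := Function.surjInv hAB
  have hs : ∀ b, algebraMap A B (s b) = b := Function.surjInv_eq hAB
  let L : B →ₗ[k] M :=
    { toFun := fun b => d (s b)
      map_add' := fun x y => by
        rw [← map_add]
        exact key _ _ (by rw [map_add, hs, hs, hs])
      map_smul' := fun c x => by
        rw [RingHom.id_apply, ← map_smul]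
        exact key _ _ (by rw [hs, Algebra.smul_def c (s x), map_mul, hs,
          ← IsScalarTower.algebraMap_apply, Algebra.smul_def]) }
  refine ⟨Derivation.mk' L fun a b => ?_, fun a => key _ _ (hs _)⟩
  have h1 : d (s (a * b)) = d (s a * s b) := key _ _ (by rw [map_mul, hs, hs, hs])
  change d (s (a * b)) = a • d (s b) + b • d (s a)
  rw [h1, Derivation.leibniz]
  conv_rhs => rw [← hs a, ← hs b, algebraMap_smul, algebraMap_smul, hs, hs]

/-! ### Differentials of a finite local algebra with principal maximal ideal -/

section LocalAlgebra

open Polynomial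

variable {L O : Type*} [Field L] [CommRing O] [Algebra L O]

/-- Expand in powers of `z`: the residue of the current remainder lies in `L`, and subtracting it
leaves a multiple of `z`. Nilpotency stops the process. -/
theorem aeval_surjective_of_maximalIdeal_eq_span [IsLocalRing O]
    (hL : Function.Surjective fun l => IsLocalRing.residue O (algebraMap L O l)) {z : O}
    (hz : IsLocalRing.maximalIdeal O = Ideal.span {z}) (hnil : IsNilpotent z) :
    Function.Surjective (aeval z : L[X] →ₐ[L] O) := by
  have key : ∀ (n : ℕ) (y : O), ∃ (p : L[X]) (w : O), y = aeval z p + z ^ n * w := by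
    intro n y
    induction n with
    | zero => exact ⟨0, y, by simp⟩
    | succ n ih =>
      obtain ⟨p, w, h⟩ := ih
      obtain ⟨l, hl⟩ := hL (IsLocalRing.residue O w)
      have : w - algebraMap L O l ∈ IsLocalRing.maximalIdeal O := by
        rw [← IsLocalRing.residue_eq_zero_iff, map_sub, ← hl, sub_self]
      rw [hz, Ideal.mem_span_singleton'] at this
      obtain ⟨w', hw'⟩ := this
      refine ⟨p + C l * X ^ n, w', ?_⟩
      have hw : w = algebraMap L O l + w' * z := by rw [hw']; ring
      rw [h, hw]
      simp only [map_add, map_mul, aeval_C, aeval_X, map_pow]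
      ring
  intro y
  obtain ⟨n, hn⟩ := hnil
  obtain ⟨p, w, h⟩ := key n y
  exact ⟨p, by rw [h, hn, zero_mul, add_zero]⟩

theorem exists_ker_aeval_eq_span_X_pow [Nontrivial O] {z : O} (hnil : IsNilpotent z) :
    ∃ ν : ℕ, 0 < ν ∧ RingHom.ker (aeval z : L[X] →ₐ[L] O) = Ideal.span {X ^ ν} := by
  obtain ⟨k, hk⟩ := hnil
  obtain ⟨g, hg⟩ := (IsPrincipalIdealRing.principal (RingHom.ker (aeval z : L[X] →ₐ[L] O))).1
  change _ = Ideal.span {g} at hg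
  have h1 : g ∣ X ^ k := by
    rw [← Ideal.mem_span_singleton, ← hg, RingHom.mem_ker]
    simpa using hk
  obtain ⟨ν, -, hν⟩ := (dvd_prime_pow Polynomial.prime_X k).1 h1
  rw [Ideal.span_singleton_eq_span_singleton.2 hν] at hg
  refine ⟨ν, Nat.pos_of_ne_zero fun h => ?_, hg⟩
  rw [h, pow_zero, Ideal.span_singleton_one] at hg
  have : (1 : L[X]) ∈ RingHom.ker (aeval z : L[X] →ₐ[L] O) := by rw [hg]; trivial
  rw [RingHom.mem_ker, map_one] at this
  exact one_ne_zero this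

theorem KaehlerDifferential.span_singleton_D_eq_top {z : O}
    (hsurj : Function.Surjective (aeval z : L[X] →ₐ[L] O)) :
    Submodule.span O {KaehlerDifferential.D L O z} = ⊤ := by
  rw [eq_top_iff, ← KaehlerDifferential.span_range_derivation, Submodule.span_le]
  rintro _ ⟨y, rfl⟩
  obtain ⟨p, rfl⟩ := hsurj y
  rw [Derivation.map_aeval]
  exact Submodule.smul_mem _ _ (Submodule.mem_span_singleton_self _)

/-- Differentiating `z^ν = 0` gives the relation. There is no other, because `p ↦ p'` modulo `ν
z^(ν-1)` kills the multiples of `X^ν`, so it descends to a derivation of `O` that sends `z` to `1`.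
-/
theorem KaehlerDifferential.smul_D_eq_zero_iff {z : O} {ν : ℕ}
    (hsurj : Function.Surjective (aeval z : L[X] →ₐ[L] O))
    (hker : RingHom.ker (aeval z : L[X] →ₐ[L] O) = Ideal.span {X ^ ν}) (s : O) :
    s • KaehlerDifferential.D L O z = 0 ↔ s ∈ Ideal.span {(ν : O) * z ^ (ν - 1)} := by
  have hzν : z ^ ν = 0 := by
    have : (X ^ ν : L[X]) ∈ RingHom.ker (aeval z : L[X] →ₐ[L] O) := by
      rw [hker]; exact Ideal.mem_span_singleton_self _
    rwa [RingHom.mem_ker, map_pow, aeval_X] at this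
  constructor
  · intro h
    set J := Ideal.span {(ν : O) * z ^ (ν - 1)}
    let : Algebra L[X] O := (aeval z : L[X] →ₐ[L] O).toRingHom.toAlgebra
    have hmap : ∀ p : L[X], algebraMap L[X] O p = aeval z p := fun _ => rfl
    have : IsScalarTower L L[X] O := IsScalarTower.of_algebraMap_eq fun l => by
      rw [hmap, Polynomial.algebraMap_eq, aeval_C]
    let d : Derivation L L[X] (O ⧸ J) := Polynomial.mkDerivation L (1 : O ⧸ J)
    have hd1 : ∀ p, d p = Ideal.Quotient.mk J (aeval z (derivative p)) := fun p => by
      rw [Polynomial.mkDerivation_apply, ← algebraMap_smul O, hmap, ← map_one (Ideal.Quotient.mk J),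
        ← Ideal.Quotient.mk_eq_mk, ← Submodule.Quotient.mk_smul, smul_eq_mul, mul_one,
        Ideal.Quotient.mk_eq_mk]
    have hd : ∀ p, algebraMap L[X] O p = 0 → d p = 0 := by
      intro p hp
      rw [hmap, ← RingHom.mem_ker, hker, Ideal.mem_span_singleton'] at hp
      obtain ⟨q, rfl⟩ := hp
      rw [hd1, Ideal.Quotient.eq_zero_iff_mem, derivative_mul, derivative_X_pow]
      simp only [map_add, map_mul, map_pow, aeval_X, hzν, mul_zero, zero_add, map_natCast]
      exact Ideal.mul_mem_left _ _ (Ideal.mem_span_singleton_self _)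
    obtain ⟨d', hd'⟩ := Derivation.exists_descend hsurj d hd
    have h2 := congrArg d'.liftKaehlerDifferential h
    rw [map_smul, Derivation.liftKaehlerDifferential_comp_D, map_zero] at h2
    have h3 : d' z = Ideal.Quotient.mk J 1 := by
      have := hd' X
      rwa [hmap, aeval_X, hd1, derivative_X, map_one] at this
    rw [h3, ← Ideal.Quotient.mk_eq_mk, ← Submodule.Quotient.mk_smul, smul_eq_mul, mul_one,
      Ideal.Quotient.mk_eq_mk, Ideal.Quotient.eq_zero_iff_mem] at h2
    exact h2
  · rw [Ideal.mem_span_singleton']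
    rintro ⟨a, rfl⟩
    have := Derivation.leibniz_pow (KaehlerDifferential.D L O) z ν
    rw [hzν, map_zero] at this
    rw [mul_smul, mul_smul, Nat.cast_smul_eq_nsmul, ← this, smul_zero]

/-- The kernel is the image of `O ⊗ Ω_{L/K}`, which is zero. This lets `Ω_{O/K}` be computed over
the coefficient field. -/
theorem KaehlerDifferential.map_injective_of_formallyUnramified (K L O : Type*) [CommRing K]
    [CommRing L] [CommRing O] [Algebra K L] [Algebra K O] [Algebra L O] [IsScalarTower K L O]
    [Algebra.FormallyUnramified K L] : Function.Injective (KaehlerDifferential.map K L O O) := by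
  rw [injective_iff_map_eq_zero]
  intro ω hω
  obtain ⟨t, rfl⟩ := (KaehlerDifferential.exact_mapBaseChange_map K L O ω).1 hω
  have : Subsingleton (Ω[L⁄K]) := inferInstance
  rw [Subsingleton.elim t 0, map_zero]

/-- The annihilator of `z^(ν-1)` is the whole maximal ideal, so the ideal it generates is a copy of
the residue field. -/
theorem finrank_span_pow_pred {K O : Type*} [Field K] [CommRing O] [IsLocalRing O] [Algebra K O]
    {z : O} (hz : IsLocalRing.maximalIdeal O = Ideal.span {z}) {ν : ℕ} (hν : 0 < ν)
    (hz0 : z ^ ν = 0) (hz1 : z ^ (ν - 1) ≠ 0) :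
    Module.finrank K (Ideal.span {z ^ (ν - 1)}) =
      Module.finrank K (IsLocalRing.ResidueField O) := by
  let f := LinearMap.toSpanSingleton O O (z ^ (ν - 1))
  have hker : LinearMap.ker f = IsLocalRing.maximalIdeal O := by
    apply le_antisymm
    · refine IsLocalRing.le_maximalIdeal fun h => hz1 ?_
      have h1 : (1 : O) ∈ LinearMap.ker f := by rw [h]; trivial
      simpa [f] using h1
    · rw [hz, Ideal.span_le, Set.singleton_subset_iff]
      change z * z ^ (ν - 1) = 0
      rw [← pow_succ', Nat.sub_add_cancel hν, hz0]
  have hrange : LinearMap.range f = Ideal.span {z ^ (ν - 1)} := LinearMap.range_toSpanSingleton _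
  rw [← hrange, ← (f.quotKerEquivRange.restrictScalars K).finrank_eq]
  exact ((Submodule.quotEquivOfEq _ _ hker).restrictScalars K).finrank_eq

theorem exists_nilpotency_index_of_section {K L O : Type*} [Field K] [Field L] [CommRing O] [IsLocalRing O]
    [Algebra K L] [Algebra K O] [Algebra L O] [IsScalarTower K L O] [Module.Finite K O]
    [Algebra.FormallyUnramified K L]
    (hL : Function.Surjective fun l => IsLocalRing.residue O (algebraMap L O l)) {z : O}
    (hz : IsLocalRing.maximalIdeal O = Ideal.span {z}) (hnil : IsNilpotent z) :
    ∃ ν : ℕ, 0 < ν ∧ Module.finrank K O = Module.finrank K L * ν ∧ z ^ ν = 0 ∧ z ^ (ν - 1) ≠ 0 ∧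
      Submodule.span O {KaehlerDifferential.D K O z} = ⊤ ∧
      ∀ s : O, s • KaehlerDifferential.D K O z = 0 ↔ s ∈ Ideal.span {(ν : O) * z ^ (ν - 1)} := by
  obtain ⟨ν, hν, hker⟩ := exists_ker_aeval_eq_span_X_pow (L := L) hnil
  have hsurj := aeval_surjective_of_maximalIdeal_eq_span hL hz hnil
  have hmem : ∀ k, z ^ k = 0 ↔ ν ≤ k := fun k => by
    have : (X ^ k : L[X]) ∈ RingHom.ker (aeval z : L[X] →ₐ[L] O) ↔ ν ≤ k := by
      rw [hker, Ideal.mem_span_singleton, pow_dvd_pow_iff Polynomial.X_ne_zero Polynomial.not_isUnit_X]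
    rwa [RingHom.mem_ker, map_pow, aeval_X] at this
  have hinj := KaehlerDifferential.map_injective_of_formallyUnramified K L O
  have hD : KaehlerDifferential.map K L O O (KaehlerDifferential.D K O z) =
      KaehlerDifferential.D L O z := by simp
  refine ⟨ν, hν, ?_, (hmem _).2 le_rfl, fun h => ?_, ?_, fun s => ?_⟩
  · rw [← Module.finrank_mul_finrank K L O]
    congr 1
    rw [← (Ideal.quotientKerAlgEquivOfSurjective hsurj).toLinearEquiv.finrank_eq,
      (Ideal.quotientEquivAlgOfEq L hker).toLinearEquiv.finrank_eq,
      finrank_quotient_span_eq_natDegree, natDegree_X_pow]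
  · have := (hmem _).1 h
    omega
  · apply Submodule.map_injective_of_injective hinj
    rw [Submodule.map_span, Set.image_singleton, hD,
      KaehlerDifferential.span_singleton_D_eq_top hsurj, Submodule.map_top, eq_comm,
      LinearMap.range_eq_top]
    exact KaehlerDifferential.map_surjective K L O
  · rw [← KaehlerDifferential.smul_D_eq_zero_iff hsurj hker, ← hD,
      ← (KaehlerDifferential.map K L O O).map_smul, map_eq_zero_iff _ hinj]

/-- Over a perfect field the residue field is formally étale, so its identity map lifts through the
nilpotent maximal ideal. -/
theorem exists_section_residueField (K O : Type*) [Field K] [PerfectField K] [CommRing O]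
    [IsLocalRing O] [Algebra K O] [Module.Finite K O] :
    ∃ s : IsLocalRing.ResidueField O →ₐ[K] O, ∀ l, IsLocalRing.residue O (s l) = l := by
  have : IsArtinianRing O := IsArtinianRing.of_finite K O
  let g : O →ₐ[K] IsLocalRing.ResidueField O := IsScalarTower.toAlgHom K O _
  have hg : Function.Surjective g := IsLocalRing.residue_surjective
  have : Module.Finite K (IsLocalRing.ResidueField O) := Module.Finite.of_surjective g.toLinearMap hg
  have hker : RingHom.ker (g : O →+* IsLocalRing.ResidueField O) = IsLocalRing.maximalIdeal O :=
    IsLocalRing.ker_residue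
  have hnil : IsNilpotent (RingHom.ker (g : O →+* IsLocalRing.ResidueField O)) := by
    rw [hker]
    exact (isArtinianRing_iff_isNilpotent_maximalIdeal O).1 inferInstance
  have : Algebra.FormallyEtale K (IsLocalRing.ResidueField O) :=
    Algebra.FormallyEtale.of_isSeparable K _
  exact ⟨Algebra.FormallySmooth.liftOfSurjective (AlgHom.id K _) g hg hnil,
    fun l => Algebra.FormallySmooth.liftOfSurjective_apply (AlgHom.id K _) g hg hnil l⟩

/-- Rank-nullity for `s ↦ s • dz`: the kernel `(ν z^(ν-1))` is zero if the characteristic divides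
`ν`, and otherwise is `(z^(ν-1))`, of dimension `κ`. -/
theorem finrank_kaehlerDifferential_of_isPrincipal_maximalIdeal (K O : Type*) [Field K]
    [PerfectField K] [CommRing O] [IsLocalRing O] [Algebra K O] [Module.Finite K O]
    (hO : (IsLocalRing.maximalIdeal O).IsPrincipal) :
    (∃ ω : Ω[O⁄K], Submodule.span O {ω} = ⊤) ∧
    (ringChar K ∣ Module.finrank K O / Module.finrank K (IsLocalRing.ResidueField O) →
      Module.finrank K (Ω[O⁄K]) = Module.finrank K O) ∧
    (¬ ringChar K ∣ Module.finrank K O / Module.finrank K (IsLocalRing.ResidueField O) →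
      Module.finrank K (Ω[O⁄K]) + Module.finrank K (IsLocalRing.ResidueField O) =
        Module.finrank K O) := by
  obtain ⟨s, hs⟩ := exists_section_residueField K O
  obtain ⟨z, hz⟩ := hO.1
  change _ = Ideal.span {z} at hz
  have : IsArtinianRing O := IsArtinianRing.of_finite K O
  have hfin : Module.Finite K (IsLocalRing.ResidueField O) :=
    Module.Finite.of_surjective (IsScalarTower.toAlgHom K O (IsLocalRing.ResidueField O)).toLinearMap
      IsLocalRing.residue_surjective
  have hnil : IsNilpotent z := by
    obtain ⟨k, hk⟩ := (isArtinianRing_iff_isNilpotent_maximalIdeal O).1 inferInstance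
    rw [hz, Ideal.span_singleton_pow, Ideal.zero_eq_bot, Ideal.span_singleton_eq_bot] at hk
    exact ⟨k, hk⟩
  have hunr : Algebra.FormallyUnramified K (IsLocalRing.ResidueField O) :=
    have := Algebra.FormallyEtale.of_isSeparable K (IsLocalRing.ResidueField O)
    inferInstance
  let : Algebra (IsLocalRing.ResidueField O) O := s.toRingHom.toAlgebra
  have : IsScalarTower K (IsLocalRing.ResidueField O) O :=
    IsScalarTower.of_algebraMap_eq fun x => (s.commutes x).symm
  obtain ⟨ν, hν, hdim, hz0, hz1, hspan, hann⟩ :=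
    @exists_nilpotency_index_of_section K (IsLocalRing.ResidueField O) O _ _ _ _ _ _ _ _ _ hunr
    (fun l => ⟨l, hs l⟩) z hz hnil
  have hκ : 0 < Module.finrank K (IsLocalRing.ResidueField O) := Module.finrank_pos
  have hdiv : Module.finrank K O / Module.finrank K (IsLocalRing.ResidueField O) = ν := by
    rw [hdim, Nat.mul_div_cancel_left _ hκ]
  let f := LinearMap.toSpanSingleton O (Ω[O⁄K]) (KaehlerDifferential.D K O z)
  have hrange : LinearMap.range f = ⊤ := by rw [LinearMap.range_toSpanSingleton, hspan]
  have hker : LinearMap.ker f = Ideal.span {(ν : O) * z ^ (ν - 1)} := by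
    ext x
    exact hann x
  have hsum : Module.finrank K (Ω[O⁄K]) + Module.finrank K (Ideal.span {(ν : O) * z ^ (ν - 1)}) =
      Module.finrank K O := by
    rw [← LinearMap.finrank_range_add_finrank_ker (f.restrictScalars K)]
    congr 1
    · have : LinearMap.range (f.restrictScalars K) = ⊤ :=
        LinearMap.range_eq_top.2 fun y => LinearMap.range_eq_top.1 hrange y
      rw [this, finrank_top]
    · rw [← hker]
      rfl
  refine ⟨⟨_, hspan⟩, fun h => ?_, fun h => ?_⟩
  · rw [hdiv, ← ringChar.spec] at h
    have h0 : (ν : O) = 0 := by rw [← map_natCast (algebraMap K O), h, map_zero]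
    rw [← hsum, h0, zero_mul, Ideal.span_singleton_eq_bot.2 rfl]
    exact (add_zero _).symm.trans
      (congrArg _ (Module.finrank_zero_of_subsingleton (M := (⊥ : Ideal O))).symm)
  · rw [hdiv, ← ringChar.spec] at h
    have h0 : IsUnit (ν : O) := by
      rw [← map_natCast (algebraMap K O)]
      exact (IsUnit.mk0 _ h).map _
    rw [← hsum, Ideal.span_singleton_mul_left_unit h0, finrank_span_pow_pred hz hν hz0 hz1]

end LocalAlgebra

/-! ### Differentials of a finite algebra as a product over its points -/

section ProductDecomposition

variable (K S : Type*) [Field K] [CommRing S] [Algebra K S]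

/-- The map from the differentials of `S` to those of its localizations at maximal ideals. -/
noncomputable def kaehlerToPi :
    Ω[S⁄K] →ₗ[S] ∀ p : MaximalSpectrum S, Ω[Localization.AtPrime p.asIdeal⁄K] :=
  LinearMap.pi fun _ => KaehlerDifferential.map K K S _

theorem kaehlerToPi_injective : Function.Injective (kaehlerToPi K S) := by
  rw [injective_iff_map_eq_zero]
  intro ω hω
  refine Module.eq_zero_of_localization_maximal (fun P [P.IsMaximal] => Ω[Localization.AtPrime P⁄K])
    (fun P [P.IsMaximal] => KaehlerDifferential.map K K S (Localization.AtPrime P)) ω fun P hP => ?_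
  exact congrFun hω ⟨P, hP⟩

theorem algebraMap_localization_surjective {S : Type*} [CommRing S] [IsArtinianRing S] (p : MaximalSpectrum S) :
    Function.Surjective (algebraMap S (Localization.AtPrime p.asIdeal)) := by
  classical
  intro y
  obtain ⟨s, hs⟩ := (MaximalSpectrum.toPiLocalizationEquiv S).surjective (Pi.single p y)
  exact ⟨s, by simpa using congrFun hs p⟩

theorem kaehlerToPi_surjective [IsArtinianRing S] : Function.Surjective (kaehlerToPi K S) := by
  classical
  have := Fintype.ofFinite (MaximalSpectrum S)
  intro w
  have h1 : ∀ p, ∃ η, KaehlerDifferential.map K K S (Localization.AtPrime p.asIdeal) η = w p :=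
    fun p => by
      have := KaehlerDifferential.map_surjective_of_surjective K K S
        (Localization.AtPrime p.asIdeal) (algebraMap_localization_surjective p)
      exact this (w p)
  choose η hη using h1
  -- The idempotents of `S` glue lifts chosen separately at each point.
  have h2 : ∀ p, ∃ e : S, MaximalSpectrum.toPiLocalizationEquiv S e = Pi.single p 1 := fun p =>
    (MaximalSpectrum.toPiLocalizationEquiv S).surjective _
  choose e he using h2
  refine ⟨∑ p, e p • η p, funext fun q => ?_⟩
  simp only [kaehlerToPi, LinearMap.pi_apply, map_sum, map_smul]
  have h3 : ∀ p, algebraMap S (Localization.AtPrime q.asIdeal) (e p) =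
      Pi.single (M := fun p : MaximalSpectrum S => Localization.AtPrime p.asIdeal) p 1 q :=
    fun p => congrFun (he p) q
  rw [Finset.sum_eq_single q]
  · rw [← algebraMap_smul (Localization.AtPrime q.asIdeal), h3, Pi.single_eq_same, one_smul, hη]
  · intro p _ hp
    rw [← algebraMap_smul (Localization.AtPrime q.asIdeal), h3, Pi.single_eq_of_ne hp.symm, zero_smul]
  · exact fun h => absurd (Finset.mem_univ q) h

end ProductDecomposition

theorem kaehlerDifferential_of_isPrincipal_maximalIdeal (K S : Type*) [Field K] [PerfectField K]
    [CommRing S] [Algebra K S] [Module.Finite K S]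
    (hS : ∀ p : MaximalSpectrum S,
      (IsLocalRing.maximalIdeal (Localization.AtPrime p.asIdeal)).IsPrincipal) :
    (∃ ω : Ω[S⁄K], Submodule.span S {ω} = ⊤) ∧
    (Module.finrank K (Ω[S⁄K]) : ℤ) = Module.finrank K S -
      ∑ᶠ (p : MaximalSpectrum S) (_ : ¬ ringChar K ∣
        Module.finrank K (Localization.AtPrime p.asIdeal) /
          Module.finrank K (IsLocalRing.ResidueField (Localization.AtPrime p.asIdeal))),
        (Module.finrank K (IsLocalRing.ResidueField (Localization.AtPrime p.asIdeal)) : ℤ) := by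
  classical
  have : IsArtinianRing S := IsArtinianRing.of_finite K S
  have : Finite (MaximalSpectrum S) := inferInstance
  have := Fintype.ofFinite (MaximalSpectrum S)
  have hfin : ∀ p : MaximalSpectrum S, Module.Finite K (Localization.AtPrime p.asIdeal) := fun p =>
    Module.Finite.of_surjective (IsScalarTower.toAlgHom K S (Localization.AtPrime p.asIdeal)).toLinearMap
      (algebraMap_localization_surjective p)
  have hloc := fun p : MaximalSpectrum S => finrank_kaehlerDifferential_of_isPrincipal_maximalIdeal K
    (Localization.AtPrime p.asIdeal) (hS p)
  constructor
  · choose v hv using fun p => (hloc p).1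
    obtain ⟨w, hw⟩ := kaehlerToPi_surjective K S v
    refine ⟨w, ?_⟩
    rw [eq_top_iff]
    intro ω _
    have h1 : ∀ p, ∃ s : Localization.AtPrime p.asIdeal, s • v p = kaehlerToPi K S ω p := fun p =>
      Submodule.mem_span_singleton.1 (hv p ▸ Submodule.mem_top)
    choose s hs using h1
    obtain ⟨t, ht⟩ := (MaximalSpectrum.toPiLocalizationEquiv S).surjective s
    rw [Submodule.mem_span_singleton]
    refine ⟨t, kaehlerToPi_injective K S ?_⟩
    funext p
    rw [← hs, map_smul, hw, ← ht, Pi.smul_apply, MaximalSpectrum.toPiLocalizationEquiv_apply_apply,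
      algebraMap_smul]
  · have hfinΩ : ∀ p : MaximalSpectrum S, Module.Finite K (Ω[Localization.AtPrime p.asIdeal⁄K]) :=
      fun p => Module.Finite.trans (Localization.AtPrime p.asIdeal) _
    have h1 : Module.finrank K (Ω[S⁄K]) =
        ∑ p : MaximalSpectrum S, Module.finrank K (Ω[Localization.AtPrime p.asIdeal⁄K]) := by
      rw [← Module.finrank_pi_fintype K]
      exact ((LinearEquiv.ofBijective (kaehlerToPi K S) ⟨kaehlerToPi_injective K S,
        kaehlerToPi_surjective K S⟩).restrictScalars K).finrank_eq
    have h2 : Module.finrank K S =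
        ∑ p : MaximalSpectrum S, Module.finrank K (Localization.AtPrime p.asIdeal) := by
      rw [← Module.finrank_pi_fintype K]
      exact ((MaximalSpectrum.toPiLocalizationEquiv S).toLinearEquiv.restrictScalars K).finrank_eq
    rw [finsum_eq_sum_of_fintype, h1, h2, Nat.cast_sum, Nat.cast_sum, ← Finset.sum_sub_distrib]
    refine Finset.sum_congr rfl fun p _ => ?_
    by_cases h : ringChar K ∣ Module.finrank K (Localization.AtPrime p.asIdeal) /
          Module.finrank K (IsLocalRing.ResidueField (Localization.AtPrime p.asIdeal))
    · rw [(hloc p).2.1 h, finsum_eq_if, if_neg (not_not.2 h), sub_zero]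
    · have h3 := (hloc p).2.2 h
      rw [finsum_eq_if, if_pos h]
      omega

/-! ### From elementwise to uniform eventual containment -/

theorem mem_of_forall_mem_of_eventually_mem_span {K M : Type*} [Field K] [AddCommGroup M]
    [Module K M] (V : ℕ → Submodule K M) {s : Set M} (h : ∀ y ∈ s, ∀ᶠ i in atTop, y ∈ V i) :
    ∀ y ∈ Submodule.span K s, ∀ᶠ i in atTop, y ∈ V i := by
  intro y hy
  induction hy using Submodule.span_induction with
  | mem x hx => exact h x hx
  | zero => exact Eventually.of_forall fun i => (V i).zero_mem
  | add x y _ _ hx hy => filter_upwards [hx, hy] with i h1 h2 using (V i).add_mem h1 h2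
  | smul a x _ hx => filter_upwards [hx] with i h1 using (V i).smul_mem a h1

theorem Submodule.FG.eventually_le {K M : Type*} [Field K] [AddCommGroup M] [Module K M]
    (V : ℕ → Submodule K M) {F : Submodule K M} (hF : F.FG)
    (h : ∀ y ∈ F, ∀ᶠ i in atTop, y ∈ V i) : ∀ᶠ i in atTop, F ≤ V i := by
  obtain ⟨t, rfl⟩ := hF
  have : ∀ᶠ i in atTop, ∀ y ∈ t, y ∈ V i :=
    (Finset.eventually_all t).2 fun y hy => h y (Submodule.subset_span hy)
  filter_upwards [this] with i hi using Submodule.span_le.2 hi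

/-! ### The grading of `R`: twists and the Euler derivation -/

namespace ZeroDimScheme

variable {K : Type*} [Field K] {n : ℕ} (X : ZeroDimScheme K n)

theorem toR_surjective : Function.Surjective X.toR := Ideal.Quotient.mkₐ_surjective K X.ideal

theorem toR_eq_zero_iff {F : MvPolynomial (Fin (n + 1)) K} : X.toR F = 0 ↔ F ∈ X.ideal :=
  Ideal.Quotient.eq_zero_iff_mem

variable {X}

theorem toR_mem_component {F : MvPolynomial (Fin (n + 1)) K} {i : ℕ} (hF : F.IsHomogeneous i) :
    X.toR F ∈ X.component i :=
  Submodule.mem_map_of_mem hF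

theorem exists_of_mem_component {f : X.R} {i : ℕ} (hf : f ∈ X.component i) :
    ∃ F : MvPolynomial (Fin (n + 1)) K, F.IsHomogeneous i ∧ X.toR F = f := hf

theorem mul_mem_component {f g : X.R} {a b : ℕ} (hf : f ∈ X.component a)
    (hg : g ∈ X.component b) : f * g ∈ X.component (a + b) := by
  obtain ⟨F, hF, rfl⟩ := exists_of_mem_component hf
  obtain ⟨G, hG, rfl⟩ := exists_of_mem_component hg
  rw [← map_mul]
  exact toR_mem_component (hF.mul hG)

theorem x_mem_component (j : Fin (n + 1)) : X.x j ∈ X.component 1 :=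
  toR_mem_component (MvPolynomial.isHomogeneous_X _ _)

theorem pow_mul_mem_component {f : X.R} {a : ℕ} (j : Fin (n + 1)) (k : ℕ)
    (hf : f ∈ X.component a) : X.x j ^ k * f ∈ X.component (k + a) := by
  induction k with
  | zero => simpa using hf
  | succ k ih =>
    have := mul_mem_component (x_mem_component j) ih
    rwa [← mul_assoc, ← pow_succ', ← add_assoc, add_comm 1] at this

instance finite_component (i : ℕ) : Module.Finite K (X.component i) :=
  Module.Finite.iff_fg.2 ((MvPolynomial.homogeneousSubmodule_fg _ _ i).map _)

theorem mem_span_iUnion_component (f : X.R) :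
    f ∈ Submodule.span K (⋃ i, (X.component i : Set X.R)) := by
  obtain ⟨F, rfl⟩ := X.toR_surjective f
  rw [← MvPolynomial.sum_homogeneousComponent F, map_sum]
  exact Submodule.sum_mem _ fun i _ => Submodule.subset_span (Set.mem_iUnion.2
    ⟨i, toR_mem_component (MvPolynomial.homogeneousComponent_isHomogeneous i F)⟩)

/-- Rescaling a homomorphism on `R` by a fixed element according to the degree. -/
theorem exists_twist {B : Type*} [CommRing B] [Algebra K B] (φ : X.R →ₐ[K] B) (c : B) :
    ∃ ψ : X.R →ₐ[K] B, ∀ i, ∀ f ∈ X.component i, ψ f = c ^ i * φ f := by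
  let ψ₀ : MvPolynomial (Fin (n + 1)) K →ₐ[K] B :=
    MvPolynomial.aeval fun j => c * φ (X.x j)
  have h₀ : ∀ i (F : MvPolynomial (Fin (n + 1)) K), F.IsHomogeneous i →
      ψ₀ F = c ^ i * φ (X.toR F) := by
    intro i F hF
    rw [F.as_sum, map_sum, map_sum, map_sum, Finset.mul_sum]
    refine Finset.sum_congr rfl fun s hs => ?_
    have hdeg : s.degree = i := (hF.degree_eq_sum_deg_support hs).symm
    rw [MvPolynomial.monomial_eq, map_mul, map_mul, map_mul, ← MvPolynomial.algebraMap_eq,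
      AlgHom.commutes, AlgHom.commutes, AlgHom.commutes, Finsupp.prod, map_prod, map_prod, map_prod,
      mul_left_comm, ← hdeg, Finsupp.degree_apply, ← Finset.prod_pow_eq_pow_sum, ← Finset.prod_mul_distrib]
    congr 1
    refine Finset.prod_congr rfl fun j _ => ?_
    rw [map_pow, map_pow, map_pow, MvPolynomial.aeval_X, mul_pow]
    rfl
  -- The twist descends to `R` because each homogeneous component of an element of the ideal is
  -- again in the ideal.
  refine ⟨Ideal.Quotient.liftₐ X.ideal ψ₀ fun F hF => ?_, fun i f hf => ?_⟩
  · rw [← MvPolynomial.sum_homogeneousComponent F, map_sum]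
    refine Finset.sum_eq_zero fun i _ => ?_
    rw [h₀ i _ (MvPolynomial.homogeneousComponent_isHomogeneous i F),
      (toR_eq_zero_iff X).2 (X.homogeneous F hF i), map_zero, mul_zero]
  · obtain ⟨F, hF, rfl⟩ := exists_of_mem_component hf
    exact h₀ i F hF

theorem algHom_ext_component {B : Type*} [CommRing B] [Algebra K B] {φ ψ : X.R →ₐ[K] B}
    (h : ∀ i, ∀ f ∈ X.component i, φ f = ψ f) : φ = ψ := by
  ext f
  have := mem_span_iUnion_component f
  induction this using Submodule.span_induction with
  | mem x hx =>
    obtain ⟨i, hi⟩ := Set.mem_iUnion.1 hx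
    exact h i x hi
  | zero => rw [map_zero, map_zero]
  | add x y _ _ hx hy => rw [map_add, map_add, hx, hy]
  | smul a x _ hx => rw [map_smul, map_smul, hx]

variable (X) in
/-- The Euler derivation, which multiplies a homogeneous element by its degree. -/
theorem exists_eulerDerivation :
    ∃ E : Derivation K X.R X.R, ∀ i, ∀ f ∈ X.component i, E f = (i : X.R) * f := by
  let : Algebra (MvPolynomial (Fin (n + 1)) K) X.R := X.toR.toRingHom.toAlgebra
  have hmap : ∀ F, algebraMap (MvPolynomial (Fin (n + 1)) K) X.R F = X.toR F := fun _ => rfl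
  have : IsScalarTower K (MvPolynomial (Fin (n + 1)) K) X.R :=
    IsScalarTower.of_algebraMap_eq fun c => (X.toR.commutes c).symm
  let D : Derivation K (MvPolynomial (Fin (n + 1)) K) (MvPolynomial (Fin (n + 1)) K) :=
    ∑ j, (MvPolynomial.X j : MvPolynomial (Fin (n + 1)) K) • MvPolynomial.pderiv j
  have hD : ∀ i (F : MvPolynomial (Fin (n + 1)) K), F.IsHomogeneous i → D F = i • F := by
    intro i F hF
    rw [← hF.sum_X_mul_pderiv]
    have := congrFun (map_sum Derivation.coeFnAddMonoidHom (fun j : Fin (n + 1) =>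
      (MvPolynomial.X j : MvPolynomial (Fin (n + 1)) K) •
        (MvPolynomial.pderiv j : Derivation K _ (MvPolynomial (Fin (n + 1)) K))) Finset.univ) F
    rw [Finset.sum_apply] at this
    exact this
  let d : Derivation K (MvPolynomial (Fin (n + 1)) K) X.R :=
    (Algebra.linearMap (MvPolynomial (Fin (n + 1)) K) X.R).compDer D
  have hd : ∀ i (F : MvPolynomial (Fin (n + 1)) K), F.IsHomogeneous i →
      d F = (i : X.R) * X.toR F := by
    intro i F hF
    change X.toR (D F) = _
    rw [hD i F hF, map_nsmul, nsmul_eq_mul]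
  obtain ⟨E, hE⟩ := Derivation.exists_descend X.toR_surjective d fun F hF => by
    rw [hmap, toR_eq_zero_iff] at hF
    rw [← MvPolynomial.sum_homogeneousComponent F, map_sum]
    refine Finset.sum_eq_zero fun i _ => ?_
    rw [hd i _ (MvPolynomial.homogeneousComponent_isHomogeneous i F),
      (toR_eq_zero_iff X).2 (X.homogeneous F hF i), mul_zero]
  refine ⟨E, fun i f hf => ?_⟩
  obtain ⟨F, hF, rfl⟩ := exists_of_mem_component hf
  exact (hE F).trans (hd i F hF)

end ZeroDimScheme

/-! ### The affine ring `S` and its comparison with `R` in large degrees -/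

namespace ZeroDimScheme

variable {K : Type*} [Field K] {n : ℕ} {X : ZeroDimScheme K n}

noncomputable instance : Algebra X.R X.S := inferInstanceAs (Algebra X.R (X.R ⧸ Ideal.span {X.x 0 - 1}))

instance : IsScalarTower K X.R X.S :=
  inferInstanceAs (IsScalarTower K X.R (X.R ⧸ Ideal.span {X.x 0 - 1}))

theorem algebraMap_S_surjective : Function.Surjective (algebraMap X.R X.S) :=
  Ideal.Quotient.mk_surjective

theorem algebraMap_S_eq_zero_iff {f : X.R} :
    algebraMap X.R X.S f = 0 ↔ f ∈ Ideal.span {X.x 0 - 1} :=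
  Ideal.Quotient.eq_zero_iff_mem

theorem algebraMap_S_x_zero : algebraMap X.R X.S (X.x 0) = 1 := by
  rw [← sub_eq_zero, ← map_one (algebraMap X.R X.S), ← map_sub, algebraMap_S_eq_zero_iff]
  exact Ideal.mem_span_singleton_self _

theorem algebraMap_S_pow_mul (k : ℕ) (f : X.R) :
    algebraMap X.R X.S (X.x 0 ^ k * f) = algebraMap X.R X.S f := by
  rw [map_mul, map_pow, algebraMap_S_x_zero, one_pow, one_mul]

-- Twist by an indeterminate `T`, sending `f` of degree `i` to `f T^i`. Then `f (x_0 - 1) = 0`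
-- becomes `ψ f = ψ f · x_0 T`, which kills all coefficients from the lowest upwards; setting `T =
-- 1` recovers `f`.
open Polynomial in
theorem x_zero_sub_one_mem_nonZeroDivisors : X.x 0 - 1 ∈ nonZeroDivisors X.R := by
  obtain ⟨ψ, hψ⟩ := exists_twist (X := X) (IsScalarTower.toAlgHom K X.R X.R[X]) (Polynomial.X)
  have hid : ((Polynomial.aeval (1 : X.R)).restrictScalars K).comp ψ = AlgHom.id K X.R := by
    refine algHom_ext_component fun i f hf => ?_
    simp [hψ i f hf]
  rw [mem_nonZeroDivisors_iff_right]
  intro f hf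
  have h1 := congrArg ψ hf
  rw [map_zero, map_mul, map_sub, map_one, hψ 1 _ (x_mem_component 0), pow_one] at h1
  have h2 : ψ f = ψ f * C (X.x 0) * Polynomial.X := by
    rw [mul_sub, mul_one, sub_eq_zero] at h1
    refine h1.symm.trans ?_
    rw [IsScalarTower.coe_toAlgHom', Polynomial.algebraMap_eq]
    ring
  have h3 : ψ f = 0 := by
    ext k
    induction k with
    | zero => rw [h2, coeff_mul_X_zero, coeff_zero]
    | succ k ih => rw [h2, coeff_mul_X, coeff_mul_C, ih, coeff_zero, zero_mul,
        coeff_zero]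
  have h4 := AlgHom.congr_fun hid f
  simpa [h3] using h4.symm

/-- Dividing by the non-zerodivisor `x_0 - 1` lowers the dimension from one to at most zero, and a
finitely generated `K`-algebra of dimension at most zero is finite over `K`. -/
instance : Module.Finite K X.S := by
  have hR : Algebra.FiniteType K X.R :=
    Algebra.FiniteType.of_surjective X.toR X.toR_surjective
  have hS : Algebra.FiniteType K X.S :=
    Algebra.FiniteType.of_surjective (IsScalarTower.toAlgHom K X.R X.S) algebraMap_S_surjective
  rw [Module.finite_iff_krullDimLE_zero, Ring.krullDimLE_iff]
  have h := ringKrullDim_quotient_succ_le_of_nonZeroDivisor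
    (x_zero_sub_one_mem_nonZeroDivisors (X := X))
  have h1 : ringKrullDim X.R = 1 := X.dimension
  rw [h1] at h
  change ringKrullDim X.S + 1 ≤ 1 at h
  rw [Nat.cast_zero]
  rw [← zero_add (1 : WithBot ℕ∞), ← add_assoc, add_zero] at h
  exact ENat.WithBot.add_le_add_one_right_iff.1 h

variable (hx₀ : X.x 0 ∈ nonZeroDivisors X.R)

variable (X) in
/-- The embedding of `S` into `R` localized at `x_0` as the homogeneous component of degree zero. -/
theorem exists_dehomogenization : ∃ σ : X.S →ₐ[K] Localization.Away (X.x 0),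
    ∀ i, ∀ f ∈ X.component i, algebraMap X.R (Localization.Away (X.x 0)) f =
      algebraMap X.R _ (X.x 0) ^ i * σ (algebraMap X.R X.S f) := by
  -- Twisting by `x_0⁻¹` sends `f` of degree `i` to `f / x_0^i`. In particular `x_0` goes to `1`, so
  -- the map factors through `S`.
  obtain ⟨ψ, hψ⟩ := exists_twist (X := X)
    (IsScalarTower.toAlgHom K X.R (Localization.Away (X.x 0))) (IsLocalization.Away.invSelf (X.x 0))
  have hinv : algebraMap X.R (Localization.Away (X.x 0)) (X.x 0) *
    IsLocalization.Away.invSelf (X.x 0) = 1 := IsLocalization.Away.mul_invSelf _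
  refine ⟨Ideal.Quotient.liftₐ (Ideal.span {X.x 0 - 1}) ψ fun f hf => ?_, fun i f hf => ?_⟩
  · obtain ⟨g, rfl⟩ := Ideal.mem_span_singleton'.1 hf
    rw [map_mul, map_sub, map_one, hψ 1 _ (x_mem_component 0), pow_one, mul_comm (IsLocalization.Away.invSelf _)]
    rw [IsScalarTower.coe_toAlgHom', hinv, sub_self, mul_zero]
  · change _ = _ * ψ f
    rw [hψ i f hf, ← mul_assoc, ← mul_pow, hinv, one_pow, one_mul]
    rfl

include hx₀ in
theorem eq_zero_of_algebraMap_S_eq_zero {f : X.R} {i : ℕ} (hf : f ∈ X.component i)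
    (h : algebraMap X.R X.S f = 0) : f = 0 := by
  obtain ⟨σ, hσ⟩ := exists_dehomogenization X
  have h1 := hσ i f hf
  rw [h, map_zero, mul_zero] at h1
  refine IsLocalization.injective (Localization.Away (X.x 0)) (M := Submonoid.powers (X.x 0))
    (Submonoid.powers_le.2 hx₀) ?_
  rw [h1, map_zero]

variable (X) in
/-- In large degrees every element of `S` has a homogeneous lift. -/
theorem eventually_exists_lift :
    ∀ᶠ i in atTop, ∀ s : X.S, ∃ f ∈ X.component i, algebraMap X.R X.S f = s := by
  let π := (IsScalarTower.toAlgHom K X.R X.S).toLinearMap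
  have key : ∀ᶠ i in atTop, (⊤ : Submodule K X.S) ≤ (X.component i).map π := by
    refine Module.Finite.fg_top.eventually_le _ fun s _ => ?_
    obtain ⟨f, rfl⟩ := algebraMap_S_surjective s
    have := mem_span_iUnion_component f
    induction this using Submodule.span_induction with
    | mem f hf =>
      obtain ⟨j, hj⟩ := Set.mem_iUnion.1 hf
      filter_upwards [eventually_ge_atTop j] with i hi
      refine ⟨X.x 0 ^ (i - j) * f, ?_, algebraMap_S_pow_mul _ _⟩
      have := pow_mul_mem_component 0 (i - j) hj
      rwa [Nat.sub_add_cancel hi] at this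
    | zero => exact Eventually.of_forall fun i => by rw [map_zero]; exact Submodule.zero_mem _
    | add x y _ _ hx hy =>
      filter_upwards [hx trivial, hy trivial] with i h1 h2
      rw [map_add]
      exact Submodule.add_mem _ h1 h2
    | smul a x _ hx =>
      filter_upwards [hx trivial] with i h1
      exact (π.map_smul a x) ▸ Submodule.smul_mem _ _ h1
  filter_upwards [key] with i hi s
  exact hi trivial

include hx₀ in
theorem eventually_finrank_component :
    ∀ᶠ i in atTop, Module.finrank K (X.component i) = Module.finrank K X.S := by
  filter_upwards [eventually_exists_lift X] with i hi
  let π := (IsScalarTower.toAlgHom K X.R X.S).toLinearMap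
  refine (LinearEquiv.ofBijective (π.domRestrict (X.component i)) ⟨?_, fun s => ?_⟩).finrank_eq
  · rw [injective_iff_map_eq_zero]
    exact fun f hf => Subtype.ext (eq_zero_of_algebraMap_S_eq_zero hx₀ f.2 hf)
  · obtain ⟨f, hf, hs⟩ := hi s
    exact ⟨⟨f, hf⟩, hs⟩

-- A lift to degree `i` of the image of `f` in `S` becomes `f` after multiplication by `x_0`, since
-- homogeneous elements of one degree are determined by their images in `S`.
include hx₀ in
theorem eventually_exists_eq_x_zero_mul :
    ∀ᶠ i in atTop, ∀ f ∈ X.component (i + 1), ∃ g ∈ X.component i, f = X.x 0 * g := by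
  filter_upwards [eventually_exists_lift X] with i hi f hf
  obtain ⟨g, hg, hgf⟩ := hi (algebraMap X.R X.S f)
  refine ⟨g, hg, ?_⟩
  rw [← sub_eq_zero]
  refine eq_zero_of_algebraMap_S_eq_zero hx₀ (i := i + 1) (Submodule.sub_mem _ hf ?_) ?_
  · have := pow_mul_mem_component 0 1 hg
    rwa [pow_one, add_comm] at this
  · rw [map_sub, map_mul, algebraMap_S_x_zero, one_mul, hgf, sub_self]

end ZeroDimScheme

/-! ### Generators of the differentials of `R` up to powers of `x_0` -/

namespace ZeroDimScheme

variable {K : Type*} [Field K] {n : ℕ} {X : ZeroDimScheme K n}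

theorem eventually_ge_shift (k : ℕ) {p : ℕ → Prop} (h : ∀ᶠ i in atTop, p i) :
    ∀ᶠ i in atTop, k ≤ i ∧ p (i - k) := by
  obtain ⟨r, hr⟩ := eventually_atTop.1 h
  filter_upwards [eventually_ge_atTop (r + k)] with i hi
  exact ⟨by omega, hr _ (by omega)⟩

variable (X) in
/-- Up to powers of `x_0`, the differentials of `R` are spanned by `dx_0` and a lift of a generator
of the differentials of `S`. -/
theorem exists_lift_generator {ω₀ : Ω[X.S⁄K]} (hω₀ : Submodule.span X.S {ω₀} = ⊤) :
    ∃ (v : Ω[X.R⁄K]) (k : ℕ),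
      (∀ b, ∀ g ∈ X.component b, ∀ᶠ N in atTop, ∃ p, ∃ a ∈ X.component p, ∃ q, ∃ c ∈ X.component q,
        p + 1 = N + b ∧ q + k = N + b ∧ X.x 0 ^ N • KaehlerDifferential.D K X.R g =
          a • KaehlerDifferential.D K X.R (X.x 0) + c • v) ∧
      ∀ i, ∀ c ∈ X.component i, algebraMap X.R X.S c • ω₀ = 0 → ∃ N, X.x 0 ^ N • c • v = 0 := by
  obtain ⟨σ, hσ⟩ := exists_dehomogenization X
  set A := Localization.Away (X.x 0)
  let : Algebra X.S A := σ.toRingHom.toAlgebra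
  have : IsScalarTower K X.S A := IsScalarTower.of_algebraMap_eq fun a => (σ.commutes a).symm
  have hσ' : ∀ s : X.S, algebraMap X.S A s = σ s := fun _ => rfl
  let f := KaehlerDifferential.map K K X.R A
  let θ := KaehlerDifferential.map K K X.S A
  set ξ := algebraMap X.R A (X.x 0) with hξ
  have hlin : ∀ (r : X.R) (ω : Ω[X.R⁄K]), f (r • ω) = algebraMap X.R A r • f ω := fun r ω => by
    rw [map_smul, algebraMap_smul]
  have hθlin : ∀ (s : X.S) (ω : Ω[X.S⁄K]), θ (s • ω) = σ s • θ ω := fun s ω => by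
    rw [map_smul, ← hσ', algebraMap_smul]
  have htors : ∀ ω, f ω = 0 → ∃ N, X.x 0 ^ N • ω = 0 := by
    intro ω hω
    obtain ⟨⟨_, N, rfl⟩, hN⟩ :=
      (IsLocalizedModule.eq_zero_iff (Submonoid.powers (X.x 0)) f).1 hω
    exact ⟨N, hN⟩
  -- Clearing the denominator `x_0^k` of the image of `ω₀` gives `v`, which therefore behaves like a
  -- form of degree `k`.
  obtain ⟨⟨v, ⟨_, k, rfl⟩⟩, hv⟩ :=
    IsLocalizedModule.surj (Submonoid.powers (X.x 0)) f (θ ω₀)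
  replace hv : f v = ξ ^ k • θ ω₀ := by
    rw [← hv, hξ, ← map_pow, algebraMap_smul]
    rfl
  have hcv : ∀ i, ∀ c ∈ X.component i,
      f (c • v) = ξ ^ (i + k) • θ (algebraMap X.R X.S c • ω₀) := by
    intro i c hc
    rw [hlin, hv, hσ i c hc, hθlin, smul_smul, smul_smul]
    congr 1
    ring
  refine ⟨v, k, fun b g hg => ?_, fun i c hc h => htors _ ?_⟩
  · obtain ⟨t, ht⟩ := Submodule.mem_span_singleton.1
      (hω₀ ▸ Submodule.mem_top : KaehlerDifferential.D K X.S (algebraMap X.R X.S g) ∈ _)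
    obtain ⟨r, hr⟩ := eventually_atTop.1 (eventually_exists_lift X)
    -- Large enough for `t` to lift to degree `N₁ + b - k ≥ r`, and positive so that `N₁ - 1` below
    -- is a genuine predecessor.
    set N₁ := r + k + 1 with hN₁
    obtain ⟨c, hc, hct⟩ := hr (N₁ + b - k) (by omega) t
    -- The coefficient of `dx_0` comes from Leibniz applied to `g = x_0^b σ(g)` in the localization:
    -- it is `b x_0^(b-1) σ(g)`, that is `b g / x_0`.
    obtain ⟨a, ha', ha⟩ : ∃ a : X.R, a = b * (X.x 0 ^ (N₁ - 1) * g) ∧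
        a ∈ X.component (N₁ - 1 + b) :=
      ⟨_, rfl, nsmul_eq_mul b (X.x 0 ^ (N₁ - 1) * g) ▸
        Submodule.smul_of_tower_mem _ b (pow_mul_mem_component 0 _ hg)⟩
    have hdg : f (X.x 0 ^ N₁ • KaehlerDifferential.D K X.R g) =
        ξ ^ (N₁ + b) • θ (KaehlerDifferential.D K X.S (algebraMap X.R X.S g)) +
        (ξ ^ N₁ * (b * ξ ^ (b - 1)) * σ (algebraMap X.R X.S g)) • KaehlerDifferential.D K A ξ := by
      rw [hlin, KaehlerDifferential.map_D, hσ b g hg, Derivation.leibniz, Derivation.leibniz_pow,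
        KaehlerDifferential.map_D, hσ', map_pow, ← Nat.cast_smul_eq_nsmul A]
      simp only [smul_add, smul_smul]
      congr 2 <;> ring
    have hau : f (a • KaehlerDifferential.D K X.R (X.x 0)) =
        (ξ ^ N₁ * (b * ξ ^ (b - 1)) * σ (algebraMap X.R X.S g)) • KaehlerDifferential.D K A ξ := by
      rw [hlin, KaehlerDifferential.map_D]
      congr 1
      rw [ha', map_mul, map_mul, hσ b g hg, map_natCast, map_pow]
      -- For `b = 0` the truncated exponent `b - 1` is harmless because of the factor `b`.
      rcases b with _ | b
      · simp
      · rw [hN₁]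
        simp only [Nat.add_sub_cancel]
        ring
    have hz : f (X.x 0 ^ N₁ • KaehlerDifferential.D K X.R g -
        (a • KaehlerDifferential.D K X.R (X.x 0) + c • v)) = 0 := by
      rw [map_sub, map_add, hdg, hau, hcv _ c hc, hct, ht, Nat.sub_add_cancel (by omega)]
      exact sub_eq_zero.2 (add_comm _ _)
    obtain ⟨N', hN'⟩ := htors _ hz
    filter_upwards [eventually_ge_atTop (N₁ + N')] with N hN
    refine ⟨_, _, pow_mul_mem_component 0 (N - N₁) ha, _, _, pow_mul_mem_component 0 (N - N₁) hc,
      by omega, by omega, ?_⟩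
    rw [← sub_eq_zero]
    have h1 : X.x 0 ^ N = X.x 0 ^ (N - N₁ - N') * X.x 0 ^ N' * X.x 0 ^ N₁ := by
      rw [← pow_add, ← pow_add]
      congr 1
      omega
    have h2 : X.x 0 ^ (N - N₁) = X.x 0 ^ (N - N₁ - N') * X.x 0 ^ N' := by
      rw [← pow_add]
      congr 1
      omega
    rw [h1, h2, mul_smul (_ * _) (X.x 0 ^ N₁), mul_smul _ a, mul_smul _ c, ← smul_add, ← smul_sub,
      mul_smul, hN', smul_zero]
  · rw [hcv i c hc, h, map_zero, smul_zero]

/-- The products of the elements of `R_i` with a fixed element of a module. -/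
noncomputable def componentSmul (X : ZeroDimScheme K n) (i : ℕ) {M : Type*} [AddCommGroup M]
    [Module X.R M] [Module K M] [IsScalarTower K X.R M] (v : M) : Submodule K M :=
  (X.component i).map ((LinearMap.toSpanSingleton X.R M v).restrictScalars K)

theorem smul_mem_componentSmul {i : ℕ} {M : Type*} [AddCommGroup M]
    [Module X.R M] [Module K M] [IsScalarTower K X.R M] (v : M) {c : X.R}
    (hc : c ∈ X.component i) : c • v ∈ X.componentSmul i v :=
  Submodule.mem_map_of_mem (f := (LinearMap.toSpanSingleton X.R M v).restrictScalars K) hc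

instance finite_componentSmul {i : ℕ} {M : Type*} [AddCommGroup M]
    [Module X.R M] [Module K M] [IsScalarTower K X.R M] (v : M) :
    Module.Finite K (X.componentSmul i v) := by
  unfold componentSmul
  infer_instance

variable (hx₀ : X.x 0 ∈ nonZeroDivisors X.R)

include hx₀ in
theorem eventually_exists_eq_x_zero_pow_mul :
    ∀ᶠ j in atTop, ∀ l, ∀ f ∈ X.component (j + l), ∃ g ∈ X.component j, f = X.x 0 ^ l * g := by
  obtain ⟨r, hr⟩ := eventually_atTop.1 (eventually_exists_eq_x_zero_mul hx₀)
  filter_upwards [eventually_ge_atTop r] with j hj l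
  induction l with
  | zero => exact fun f hf => ⟨f, hf, by rw [pow_zero, one_mul]⟩
  | succ l ih =>
    intro f hf
    obtain ⟨g, hg, rfl⟩ := hr (j + l) (by omega) f hf
    obtain ⟨g', hg', rfl⟩ := ih g hg
    exact ⟨g', hg', by ring⟩

-- For large `i`, any `c` of degree `i` that kills `w` also kills `v`, so `R_i v` is no larger than
-- a subspace of `W`. One power of `x_0` suffices for all such `c`, because they are multiples of
-- elements of a finite-dimensional subspace of one fixed `R_j`.
include hx₀ in
theorem eventually_finrank_componentSmul_le {W M : Type*} [AddCommGroup W] [Module X.S W]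
    [Module K W] [IsScalarTower K X.S W] [Module.Finite K W] [AddCommGroup M]
    [Module X.R M] [Module K M] [IsScalarTower K X.R M] (v : M) (w : W)
    (h : ∀ i, ∀ c ∈ X.component i, algebraMap X.R X.S c • w = 0 → ∃ N, X.x 0 ^ N • c • v = 0) :
    ∀ᶠ i in atTop, Module.finrank K (X.componentSmul i v) ≤ Module.finrank K W := by
  let φ : X.R →ₗ[K] M := (LinearMap.toSpanSingleton X.R M v).restrictScalars K
  let τ : X.R →ₗ[K] W := ((LinearMap.toSpanSingleton X.S W w).restrictScalars K).comp
    (IsScalarTower.toAlgHom K X.R X.S).toLinearMap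
  obtain ⟨j, hj⟩ := (eventually_exists_eq_x_zero_pow_mul hx₀).exists
  let F : Submodule K X.R := X.component j ⊓ LinearMap.ker τ
  have hF : F.FG := Module.Finite.iff_fg.1 (Submodule.finiteDimensional_inf_left _ _)
  have h1 := hF.eventually_le (fun N => LinearMap.ker (φ.comp (LinearMap.mulLeft K (X.x 0 ^ N))))
    (fun c hc => by
      obtain ⟨N, hN⟩ := h j c hc.1 hc.2
      filter_upwards [eventually_ge_atTop N] with N' hN'
      change (X.x 0 ^ N' * c) • v = 0
      rw [← Nat.sub_add_cancel hN', pow_add, mul_assoc, mul_smul, mul_smul, hN, smul_zero])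
  obtain ⟨N, hN⟩ := eventually_atTop.1 h1
  filter_upwards [eventually_ge_atTop (j + N)] with i hi
  have hker : ∀ c ∈ X.component i, τ c = 0 → φ c = 0 := by
    intro c hc hτ
    obtain ⟨l, rfl⟩ := Nat.exists_eq_add_of_le (show j ≤ i by omega)
    obtain ⟨c', hc', rfl⟩ := hj l c hc
    refine hN l (by omega) ⟨hc', ?_⟩
    change algebraMap X.R X.S c' • w = 0
    rw [← algebraMap_S_pow_mul l]
    exact hτ
  let φ' := φ.domRestrict (X.component i)
  let τ' := τ.domRestrict (X.component i)
  have hle : LinearMap.ker τ' ≤ LinearMap.ker φ' := fun c hc => hker c c.2 hc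
  have e1 := LinearMap.finrank_range_add_finrank_ker φ'
  have e2 := LinearMap.finrank_range_add_finrank_ker τ'
  have e3 := Submodule.finrank_mono hle
  have e4 := Submodule.finrank_le (LinearMap.range τ')
  have e5 : X.componentSmul i v = LinearMap.range φ' := (LinearMap.range_domRestrict _ _).symm
  rw [e5]
  omega

end ZeroDimScheme

/-! ### Alternating maps on combinations of two vectors -/

/-- An alternating map in at least three arguments vanishes on combinations of two vectors. -/
theorem AlternatingMap.map_combination_of_two {R M N : Type*} [CommRing R] [AddCommGroup M]
    [Module R M] [AddCommGroup N] [Module R N] {m : ℕ} (hm : 2 < m) (φ : M [⋀^Fin m]→ₗ[R] N)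
    (u v : M) (a c : Fin m → R) : φ (fun k => a k • u + c k • v) = 0 := by
  let l : (Fin 2 → R) →ₗ[R] M := Fintype.linearCombination R ![u, v]
  -- After pullback to `R^2` it suffices to test on distinct basis vectors, and there are only two.
  have h0 : φ.compLinearMap l = 0 := by
    refine Module.Basis.ext_alternating (Pi.basisFun R (Fin 2)) fun w hw => ?_
    have := Fintype.card_le_of_injective w hw
    simp only [Fintype.card_fin] at this
    omega
  have h1 := DFunLike.congr_fun h0 fun k => ![a k, c k]
  rw [AlternatingMap.compLinearMap_apply] at h1
  simpa [l, Fintype.linearCombination_apply, Fin.sum_univ_two] using h1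

theorem AlternatingMap.map_pair_combination {R M N : Type*} [CommRing R] [AddCommGroup M]
    [Module R M] [AddCommGroup N] [Module R N] (φ : M [⋀^Fin 2]→ₗ[R] N)
    (u v : M) (a c a' c' : R) :
    φ ![a • u + c • v, a' • u + c' • v] = (a * c' - a' * c) • φ ![u, v] := by
  have e0 : ∀ x z w : M, Function.update ![x, z] 0 w = ![w, z] := fun x z w => by
    ext i; fin_cases i <;> rfl
  have e1 : ∀ x z w : M, Function.update ![z, x] 1 w = ![z, w] := fun x z w => by
    ext i; fin_cases i <;> rfl
  have h1 : ∀ x y z : M, φ ![x + y, z] = φ ![x, z] + φ ![y, z] := fun x y z => by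
    rw [← e0 x z (x + y), φ.map_update_add, e0, e0]
  have h2 : ∀ x y z : M, φ ![z, x + y] = φ ![z, x] + φ ![z, y] := fun x y z => by
    rw [← e1 x z (x + y), φ.map_update_add, e1, e1]
  have h3 : ∀ (r : R) (x z : M), φ ![r • x, z] = r • φ ![x, z] := fun r x z => by
    rw [← e0 x z (r • x), φ.map_update_smul, e0]
  have h4 : ∀ (r : R) (x z : M), φ ![z, r • x] = r • φ ![z, x] := fun r x z => by
    rw [← e1 x z (r • x), φ.map_update_smul, e1]
  have h5 : ∀ x, φ ![x, x] = 0 := fun x => φ.map_eq_zero_of_eq _ (i := 0) (j := 1) rfl (by decide)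
  have h6 : φ ![v, u] = - φ ![u, v] := by
    have := h5 (u + v)
    rw [h1, h2, h2, h5, h5, zero_add, add_zero] at this
    exact (neg_eq_of_add_eq_zero_right this).symm
  rw [h1, h2, h2, h3, h3, h3, h3, h4, h4, h4, h4, h5, h5, h6]
  module

/-! ### Homogeneous components of the modules of forms -/

namespace ZeroDimScheme

variable {K : Type*} [Field K] {n : ℕ} {X : ZeroDimScheme K n}

theorem smul_ιMulti_mem_omegaComponent {m a i : ℕ} {b : Fin m → ℕ} {f : X.R} {g : Fin m → X.R}
    (hf : f ∈ X.component a) (hg : ∀ k, g k ∈ X.component (b k)) (hi : a + ∑ k, b k = i) :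
    f • exteriorPower.ιMulti X.R m (fun k => KaehlerDifferential.D K X.R (g k)) ∈
      X.omegaComponent m i :=
  Submodule.subset_span ⟨a, b, f, g, hf, hg, hi, rfl⟩

theorem omegaComponent_le {m i : ℕ} {T : Submodule K (X.Omega m)}
    (h : ∀ (a : ℕ) (b : Fin m → ℕ) (f : X.R) (g : Fin m → X.R), f ∈ X.component a →
      (∀ k, g k ∈ X.component (b k)) → a + ∑ k, b k = i →
      f • exteriorPower.ιMulti X.R m (fun k => KaehlerDifferential.D K X.R (g k)) ∈ T) :
    X.omegaComponent m i ≤ T := by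
  refine Submodule.span_le.2 ?_
  rintro _ ⟨a, b, f, g, hf, hg, hi, rfl⟩
  exact h a b f g hf hg hi

theorem fg_span_range_multilinear {M : Type*} [AddCommGroup M] [Module K M] {m : ℕ}
    {V : Fin m → Type*} [∀ k, AddCommGroup (V k)] [∀ k, Module K (V k)]
    [∀ k, Module.Finite K (V k)] (φ : MultilinearMap K V M) :
    (Submodule.span K (Set.range φ)).FG := by
  have h : Submodule.span K (Set.range φ) ≤ LinearMap.range (PiTensorProduct.lift φ) := by
    refine Submodule.span_le.2 ?_
    rintro _ ⟨x, rfl⟩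
    exact ⟨PiTensorProduct.tprod K x, PiTensorProduct.lift.tprod x⟩
  have : Module.Finite K (LinearMap.range (PiTensorProduct.lift φ)) := inferInstance
  exact Module.Finite.iff_fg.1 (Submodule.finiteDimensional_of_le h)

/-- All degrees involved are at most `i`, so finitely many degree patterns occur, each contributing
a finite-dimensional span. -/
instance finite_omegaComponent (m i : ℕ) : Module.Finite K (X.omegaComponent m i) := by
  let φ : ∀ b : Fin m → ℕ, MultilinearMap K (fun k => X.component (b k)) (X.Omega m) := fun b =>
    ((exteriorPower.ιMulti X.R m (M := Ω[X.R⁄K])).toMultilinearMap.restrictScalars K).compLinearMap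
      fun k => (KaehlerDifferential.D K X.R).toLinearMap.comp (X.component (b k)).subtype
  let T : Submodule K (X.Omega m) := ⨆ a : Fin (i + 1), ⨆ b : Fin m → Fin (i + 1),
    Submodule.map₂ ((LinearMap.lsmul X.R (X.Omega m)).restrictScalars₁₂ K K) (X.component a)
      (Submodule.span K (Set.range (φ fun k => b k)))
  have hT : T.FG := Submodule.fg_iSup _ fun a => Submodule.fg_iSup _ fun b =>
    (Module.Finite.iff_fg.1 inferInstance).map₂ _ (fg_span_range_multilinear _)
  have : Module.Finite K T := Module.Finite.iff_fg.2 hT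
  refine Submodule.finiteDimensional_of_le (S₂ := T) (omegaComponent_le fun a b f g hf hg hab => ?_)
  have hb : ∀ k, b k < i + 1 := fun k => by
    have := Finset.single_le_sum (f := b) (fun _ _ => Nat.zero_le _) (Finset.mem_univ k)
    omega
  refine Submodule.mem_iSup_of_mem (⟨a, by omega⟩ : Fin (i + 1)) (Submodule.mem_iSup_of_mem
    (fun k => (⟨b k, hb k⟩ : Fin (i + 1))) ?_)
  exact Submodule.apply_mem_map₂ _ hf (Submodule.subset_span ⟨fun k => ⟨g k, hg k⟩, rfl⟩)

variable (hx₀ : X.x 0 ∈ nonZeroDivisors X.R)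

-- In large total degree, either the coefficient or some `g_k` has large degree. A coefficient
-- yields a factor `x_0` directly. For `g_k`, two factors are needed: `d(x_0² g') = x_0 (x_0 dg' + 2
-- g' dx_0)`.
include hx₀ in
theorem eventually_omegaComponent_succ_le (m : ℕ) :
    ∀ᶠ i in atTop, ∀ w ∈ X.omegaComponent m (i + 1), ∃ w' ∈ X.omegaComponent m i,
      w = X.x 0 • w' := by
  obtain ⟨r, hr⟩ := eventually_atTop.1 (eventually_exists_eq_x_zero_mul hx₀)
  -- Pigeonhole over the `m + 1` degrees of `f, g_1, …, g_m`.
  filter_upwards [eventually_ge_atTop ((m + 1) * (r + 2))] with i hi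
  let μ : X.Omega m →ₗ[K] X.Omega m := (LinearMap.lsmul X.R (X.Omega m) (X.x 0)).restrictScalars K
  have hμ : ∀ w, μ w = X.x 0 • w := fun _ => rfl
  suffices h : X.omegaComponent m (i + 1) ≤ (X.omegaComponent m i).map μ by
    intro w hw
    obtain ⟨w', hw', rfl⟩ := h hw
    exact ⟨w', hw', rfl⟩
  refine omegaComponent_le fun a b f g hf hg hab => ?_
  by_cases ha : r + 1 ≤ a
  · obtain ⟨a, rfl⟩ := Nat.exists_eq_add_of_le' (show 1 ≤ a by omega)
    obtain ⟨f', hf', rfl⟩ := hr a (by omega) f hf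
    refine ⟨_, smul_ιMulti_mem_omegaComponent hf' hg (by omega), ?_⟩
    exact (mul_smul (X.x 0) f' _).symm
  · obtain ⟨k, hk⟩ : ∃ k, r + 2 ≤ b k := by
      by_contra! hlt
      have : ∑ k, b k ≤ ∑ _k : Fin m, (r + 2) := Finset.sum_le_sum fun k _ => (hlt k).le
      rw [Finset.sum_const, Finset.card_univ, Fintype.card_fin, smul_eq_mul] at this
      rw [add_mul, one_mul] at hi
      omega
    obtain ⟨β, hβ⟩ := Nat.exists_eq_add_of_le' (show 2 ≤ b k by omega)
    obtain ⟨g₁, hg₁, hgk⟩ := hr (β + 1) (by omega) (g k) (by rw [add_assoc, ← hβ]; exact hg k)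
    obtain ⟨g', hg', rfl⟩ := hr β (by omega) g₁ hg₁
    have hupd : ∀ (h : X.R), (fun l => KaehlerDifferential.D K X.R (Function.update g k h l)) =
        Function.update (fun l => KaehlerDifferential.D K X.R (g l)) k
          (KaehlerDifferential.D K X.R h) := fun h => by
      funext l
      rw [Function.apply_update (fun _ => KaehlerDifferential.D K X.R)]
    have hmem : ∀ (h : X.R) (c : ℕ), h ∈ X.component c →
        ∀ l, Function.update g k h l ∈ X.component (Function.update b k c l) := by
      intro h c hc l
      rcases eq_or_ne l k with rfl | hl
      · simpa using hc
      · simpa [hl] using hg l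
    have hsum : ∀ c, ∑ l, Function.update b k c l + b k = c + ∑ l, b l := by
      intro c
      rw [Finset.sum_update_of_mem (Finset.mem_univ k),
        ← Finset.add_sum_erase Finset.univ b (Finset.mem_univ k), Finset.sdiff_singleton_eq_erase]
      omega
    have h1 := smul_ιMulti_mem_omegaComponent (i := i)
      (mul_mem_component (x_mem_component 0) hf) (hmem g' β hg') (by have := hsum β; omega)
    have h2 := smul_ιMulti_mem_omegaComponent (i := i)
      (Submodule.smul_of_tower_mem _ 2 (mul_mem_component hf hg')) (hmem (X.x 0) 1 (x_mem_component 0))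
      (by have := hsum 1; omega)
    refine ⟨_, Submodule.add_mem _ h1 h2, ?_⟩
    have hself : (fun l => KaehlerDifferential.D K X.R (g l)) =
        Function.update (fun l => KaehlerDifferential.D K X.R (g l)) k
          (X.x 0 • (X.x 0 • KaehlerDifferential.D K X.R g' +
            (2 * g') • KaehlerDifferential.D K X.R (X.x 0))) := by
      rw [eq_comm, Function.update_eq_self_iff, hgk, Derivation.leibniz, Derivation.leibniz]
      module
    rw [hself, hupd, hupd]
    simp only [AlternatingMap.map_update_smul, AlternatingMap.map_update_add]
    rw [hμ]
    module

include hx₀ in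
theorem eventually_omegaComponent_add_le (m : ℕ) :
    ∀ᶠ j in atTop, ∀ l, ∀ w ∈ X.omegaComponent m (j + l), ∃ w' ∈ X.omegaComponent m j,
      w = X.x 0 ^ l • w' := by
  obtain ⟨r, hr⟩ := eventually_atTop.1 (eventually_omegaComponent_succ_le hx₀ m)
  filter_upwards [eventually_ge_atTop r] with j hj l
  induction l with
  | zero => exact fun f hf => ⟨f, hf, by rw [pow_zero, one_smul]⟩
  | succ l ih =>
    intro f hf
    obtain ⟨g, hg, rfl⟩ := hr (j + l) (by omega) f hf
    obtain ⟨g', hg', rfl⟩ := ih g hg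
    exact ⟨g', hg', by rw [pow_succ', mul_smul]⟩

include hx₀ in
/-- If every form is multiplied into a family of subspaces by large powers of `x_0`, then the
homogeneous forms of large degree lie in that family. -/
theorem eventually_omegaComponent_le (m : ℕ) (T : ℕ → Submodule K (X.Omega m))
    (hT : ∀ (i a : ℕ) (b : Fin m → ℕ) (f : X.R) (g : Fin m → X.R), f ∈ X.component a →
      (∀ k, g k ∈ X.component (b k)) → a + ∑ k, b k = i →
      ∀ᶠ N in atTop, X.x 0 ^ N • f •
        exteriorPower.ιMulti X.R m (fun k => KaehlerDifferential.D K X.R (g k)) ∈ T (N + i)) :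
    ∀ᶠ i in atTop, X.omegaComponent m i ≤ T i := by
  obtain ⟨j, hj⟩ := (eventually_omegaComponent_add_le hx₀ m).exists
  let V : ℕ → Submodule K (X.Omega m) := fun N => (T (N + j)).comap
    ((LinearMap.lsmul X.R (X.Omega m) (X.x 0 ^ N)).restrictScalars K)
  -- Forms of degree `j + l` are `x_0^l` times forms of degree `j`, and finite dimensionality of the
  -- latter makes the required power uniform.
  have h := (Module.Finite.iff_fg.1 (finite_omegaComponent m j)).eventually_le V
    (mem_of_forall_mem_of_eventually_mem_span V (by
      rintro _ ⟨a, b, f, g, hf, hg, hi, rfl⟩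
      exact hT j a b f g hf hg hi))
  obtain ⟨N₀, hN₀⟩ := eventually_atTop.1 h
  filter_upwards [eventually_ge_atTop (j + N₀)] with i hi w hw
  obtain ⟨l, rfl⟩ := Nat.exists_eq_add_of_le (show j ≤ i by omega)
  obtain ⟨w', hw', rfl⟩ := hj l w hw
  rw [add_comm j l]
  exact hN₀ l (by omega) hw'

end ZeroDimScheme

theorem KaehlerDifferential.span_smul_D_eq_top (K S : Type*) [Field K] [CommRing S] [Algebra K S] :
    Submodule.span K {ω : Ω[S⁄K] | ∃ s t : S, ω = s • KaehlerDifferential.D K S t} = ⊤ := by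
  rw [eq_top_iff]
  intro ω _
  have h : ω ∈ Submodule.span S (Set.range (KaehlerDifferential.D K S)) := by
    rw [KaehlerDifferential.span_range_derivation]
    trivial
  induction h using Submodule.closure_induction with
  | zero => exact Submodule.zero_mem _
  | add x y _ _ hx hy => exact Submodule.add_mem _ (hx trivial) (hy trivial)
  | smul_mem s x hx =>
    obtain ⟨t, rfl⟩ := hx
    exact Submodule.subset_span ⟨s, t, rfl⟩

namespace ZeroDimScheme

variable {K : Type*} [Field K] {n : ℕ} {X : ZeroDimScheme K n}

instance : Module.Finite K (Ω[X.S⁄K]) := Module.Finite.trans X.S _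

/-! ### Lower bounds from the Euler derivation -/

section LowerBounds

theorem eventually_finrank_le_of_map {W : Type*} [AddCommGroup W] [Module K W] [Module.Finite K W]
    (m : ℕ) (ψ : X.Omega m →ₗ[K] W) {Y : Set W} (hY : Submodule.span K Y = ⊤)
    (h : ∀ y ∈ Y, ∀ᶠ i in atTop, y ∈ (X.omegaComponent m i).map ψ) :
    ∀ᶠ i in atTop, Module.finrank K W ≤ X.omegaHilbertFunction m i := by
  have h1 := (Module.Finite.fg_top (R := K) (M := W)).eventually_le _ fun y _ =>
    mem_of_forall_mem_of_eventually_mem_span (fun i => (X.omegaComponent m i).map ψ) h y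
      (hY ▸ Submodule.mem_top)
  filter_upwards [h1] with i hi
  rw [← finrank_top K W, ← top_le_iff.1 hi]
  exact Submodule.finrank_map_le _ _

theorem eventually_exists_lift_shift (b : ℕ) :
    ∀ᶠ i in atTop, b ≤ i ∧ ∀ s : X.S, ∃ f ∈ X.component (i - b), algebraMap X.R X.S f = s :=
  eventually_ge_shift b (eventually_exists_lift X)

theorem exists_homogeneous_lift (t : X.S) :
    ∃ b, ∃ g ∈ X.component b, algebraMap X.R X.S g = t := by
  obtain ⟨b, hb⟩ := (eventually_exists_lift X).exists
  exact ⟨b, hb t⟩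

theorem algebraMap_smul_eq {W : Type*} [AddCommGroup W] [Module X.S W] [Module X.R W]
    [IsScalarTower X.R X.S W] (c : X.R) (w : W) : c • w = algebraMap X.R X.S c • w :=
  (algebraMap_smul X.S c w).symm

-- Pair contraction with the Euler derivation with restriction to `S`. Since `x_0` becomes `1` in
-- `S`, the form `c dx_0` maps to `(c, 0)`; subtracting such an element from the image of `c dg`
-- leaves `(0, c dg)`.
variable (X) in
theorem eventually_le_omegaHilbertFunction_one :
    ∀ᶠ i in atTop, Module.finrank K X.S + Module.finrank K (Ω[X.S⁄K]) ≤
      X.omegaHilbertFunction 1 i := by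
  obtain ⟨E, hE⟩ := exists_eulerDerivation X
  let ψ₁ : Ω[X.R⁄K] →ₗ[X.R] X.S × Ω[X.S⁄K] :=
    ((Algebra.linearMap X.R X.S).comp E.liftKaehlerDifferential).prod
      (KaehlerDifferential.map K K X.R X.S)
  let ψ : X.Omega 1 →ₗ[K] X.S × Ω[X.S⁄K] :=
    (ψ₁.comp (exteriorPower.oneEquiv X.R (Ω[X.R⁄K])).toLinearMap).restrictScalars K
  have hψ : ∀ (b : ℕ) (c g : X.R), g ∈ X.component b →
      ψ (c • exteriorPower.ιMulti X.R 1 fun _ => KaehlerDifferential.D K X.R g) =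
        (algebraMap X.R X.S c * (b * algebraMap X.R X.S g),
          algebraMap X.R X.S c • KaehlerDifferential.D K X.S (algebraMap X.R X.S g)) := by
    intro b c g hg
    change ψ₁ (exteriorPower.oneEquiv X.R _ (c • _)) = _
    rw [map_smul, exteriorPower.oneEquiv_ιMulti, map_smul, algebraMap_smul_eq]
    refine Prod.ext ?_ ?_
    · change algebraMap X.R X.S c * algebraMap X.R X.S (E.liftKaehlerDifferential _) = _
      rw [Derivation.liftKaehlerDifferential_comp_D, hE b g hg, map_mul, map_natCast]
    · change algebraMap X.R X.S c • KaehlerDifferential.map K K X.R X.S _ = _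
      rw [KaehlerDifferential.map_D]
  have hmem : ∀ (a b i : ℕ) (c g : X.R), c ∈ X.component a → g ∈ X.component b → a + b = i →
      (algebraMap X.R X.S c * (b * algebraMap X.R X.S g),
          algebraMap X.R X.S c • KaehlerDifferential.D K X.S (algebraMap X.R X.S g)) ∈
        (X.omegaComponent 1 i).map ψ := by
    intro a b i c g hc hg hab
    rw [← hψ b c g hg]
    exact Submodule.mem_map_of_mem (smul_ιMulti_mem_omegaComponent (b := fun _ => b) hc
      (fun _ => hg) (by simpa using hab))
  have hfst : ∀ s : X.S, ∀ᶠ i in atTop,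
      ((s, 0) : X.S × Ω[X.S⁄K]) ∈ (X.omegaComponent 1 i).map ψ := by
    intro s
    filter_upwards [eventually_exists_lift_shift (X := X) 1] with i hi
    obtain ⟨c, hc, rfl⟩ := hi.2 s
    have := hmem _ 1 i c (X.x 0) hc (x_mem_component 0) (by omega)
    simpa [algebraMap_S_x_zero] using this
  rw [← Module.finrank_prod]
  refine eventually_finrank_le_of_map 1 ψ
    (Y := {y | ∃ s : X.S, y = (s, 0)} ∪ {y | ∃ s t : X.S, y = (0, s • KaehlerDifferential.D K X.S t)}) ?_ ?_
  · rw [eq_top_iff]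
    rintro ⟨s, ω⟩ -
    have h1 : ((s, 0) : X.S × Ω[X.S⁄K]) ∈ Submodule.span K
        ({y | ∃ s : X.S, y = (s, 0)} ∪ {y | ∃ s t : X.S, y = (0, s • KaehlerDifferential.D K X.S t)}) :=
      Submodule.subset_span (Or.inl ⟨s, rfl⟩)
    have h2 : (⊤ : Submodule K (Ω[X.S⁄K])) ≤ (Submodule.span K
        ({y | ∃ s : X.S, y = (s, 0)} ∪ {y | ∃ s t : X.S, y = (0, s • KaehlerDifferential.D K X.S t)})).comap
          (LinearMap.inr K X.S (Ω[X.S⁄K])) := by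
      rw [← KaehlerDifferential.span_smul_D_eq_top, Submodule.span_le]
      rintro _ ⟨s, t, rfl⟩
      exact Submodule.subset_span (Or.inr ⟨s, t, rfl⟩)
    have h3 := Submodule.add_mem _ h1 (h2 (x := ω) trivial)
    simpa using h3
  · rintro y (⟨s, rfl⟩ | ⟨s, t, rfl⟩)
    · exact hfst s
    · obtain ⟨b, g, hg, rfl⟩ := exists_homogeneous_lift t
      filter_upwards [eventually_exists_lift_shift (X := X) b,
        hfst (s * (b * algebraMap X.R X.S g))] with i hi hi'
      obtain ⟨c, hc, rfl⟩ := hi.2 s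
      have := Submodule.sub_mem _ (hmem _ b i c g hc hg (by omega)) hi'
      simpa using this

-- Contract 2-forms with the Euler derivation and restrict to `S`: as `dx_0` restricts to `d1 = 0`,
-- the form `c dx_0 ∧ dg` maps to `c dg`.
variable (X) in
theorem eventually_le_omegaHilbertFunction_two :
    ∀ᶠ i in atTop, Module.finrank K (Ω[X.S⁄K]) ≤ X.omegaHilbertFunction 2 i := by
  obtain ⟨E, hE⟩ := exists_eulerDerivation X
  let ε := E.liftKaehlerDifferential
  let π := KaehlerDifferential.map K K X.R X.S
  let φ : Ω[X.R⁄K] [⋀^Fin 2]→ₗ[X.R] Ω[X.S⁄K] :=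
    { toFun := fun w => ε (w 0) • π (w 1) - ε (w 1) • π (w 0)
      map_update_add' := fun w i x y => by
        fin_cases i <;> simp <;> module
      map_update_smul' := fun w i c x => by
        fin_cases i <;> simp <;> module
      map_eq_zero_of_eq' := fun w i j hw hij => by
        have : w 0 = w 1 := by
          fin_cases i <;> fin_cases j
          · exact absurd rfl hij
          · exact hw
          · exact hw.symm
          · exact absurd rfl hij
        change ε (w 0) • π (w 1) - ε (w 1) • π (w 0) = 0
        rw [this, sub_self] }
  let ψ : X.Omega 2 →ₗ[K] Ω[X.S⁄K] :=
    (exteriorPower.alternatingMapLinearEquiv φ).restrictScalars K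
  refine eventually_finrank_le_of_map 2 ψ (KaehlerDifferential.span_smul_D_eq_top K X.S) ?_
  rintro _ ⟨s, t, rfl⟩
  obtain ⟨b, g, hg, rfl⟩ := exists_homogeneous_lift t
  filter_upwards [eventually_exists_lift_shift (X := X) (b + 1)] with i hi
  obtain ⟨c, hc, rfl⟩ := hi.2 s
  refine ⟨_, smul_ιMulti_mem_omegaComponent (i := i) (b := ![1, b]) (g := ![X.x 0, g]) hc ?_ ?_, ?_⟩
  · intro k
    fin_cases k
    · exact x_mem_component 0
    · exact hg
  · simp only [Fin.sum_univ_two, Matrix.cons_val_zero, Matrix.cons_val_one]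
    omega
  · change exteriorPower.alternatingMapLinearEquiv φ (c • _) = _
    rw [map_smul, exteriorPower.alternatingMapLinearEquiv_apply_ιMulti]
    change c • (ε (KaehlerDifferential.D K X.R (X.x 0)) • π (KaehlerDifferential.D K X.R g) -
      ε (KaehlerDifferential.D K X.R g) • π (KaehlerDifferential.D K X.R (X.x 0))) = _
    rw [Derivation.liftKaehlerDifferential_comp_D, Derivation.liftKaehlerDifferential_comp_D,
      hE 1 _ (x_mem_component 0), KaehlerDifferential.map_D, KaehlerDifferential.map_D,
      algebraMap_S_x_zero, Derivation.map_one_eq_zero, smul_zero, sub_zero, Nat.cast_one, one_mul,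
      algebraMap_smul_eq (X.x 0), algebraMap_S_x_zero, one_smul, algebraMap_smul_eq]

end LowerBounds

/-! ### Upper bounds from the generators `dx_0` and `v` -/

section UpperBounds

variable (hx₀ : X.x 0 ∈ nonZeroDivisors X.R) {ω₀ : Ω[X.S⁄K]}
  (hω₀ : Submodule.span X.S {ω₀} = ⊤)

include hx₀ hω₀

theorem eventually_omegaHilbertFunction_eq_zero {m : ℕ} (hm : 2 < m) :
    ∀ᶠ i in atTop, X.omegaHilbertFunction m i = 0 := by
  obtain ⟨v, k, hv, -⟩ := exists_lift_generator X hω₀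
  have h := eventually_omegaComponent_le hx₀ m (fun _ => ⊥) (fun i a b f g hf hg hi => by
    have h1 : ∀ l, ∃ N, ∃ a c : X.R, X.x 0 ^ N • KaehlerDifferential.D K X.R (g l) =
        a • KaehlerDifferential.D K X.R (X.x 0) + c • v := fun l => by
      obtain ⟨N, _, a, _, _, c, _, _, _, h⟩ := (hv _ _ (hg l)).exists
      exact ⟨N, a, c, h⟩
    choose N α γ hN using h1
    have h2 : X.x 0 ^ (∑ l, N l) •
        exteriorPower.ιMulti X.R m (fun l => KaehlerDifferential.D K X.R (g l)) = 0 := by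
      rw [← Finset.prod_pow_eq_pow_sum, ← AlternatingMap.map_smul_univ]
      simp only [hN]
      exact AlternatingMap.map_combination_of_two hm _ _ _ _ _
    filter_upwards [eventually_ge_atTop (∑ l, N l)] with N' hN'
    rw [Submodule.mem_bot, ← Nat.sub_add_cancel hN', pow_add, mul_smul, smul_comm _ f, h2, smul_zero,
      smul_zero])
  filter_upwards [h] with i hi
  have := Submodule.finrank_mono hi
  rw [finrank_bot] at this
  exact Nat.le_zero.1 this

theorem eventually_omegaHilbertFunction_one_le :
    ∀ᶠ i in atTop, X.omegaHilbertFunction 1 i ≤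
      Module.finrank K X.S + Module.finrank K (Ω[X.S⁄K]) := by
  obtain ⟨v, k, hv, hv'⟩ := exists_lift_generator X hω₀
  let e := (exteriorPower.oneEquiv X.R (Ω[X.R⁄K])).symm
  let u' := e (KaehlerDifferential.D K X.R (X.x 0))
  have h := eventually_omegaComponent_le hx₀ 1
    -- The generators `dx_0` and `v` count as degrees `1` and `k`; truncation of the subtractions is
    -- irrelevant for large `i`.
    (fun i => X.componentSmul (i - 1) u' ⊔ X.componentSmul (i - k) (e v))
    (fun i a b f g hf hg hi => by
      filter_upwards [hv _ _ (hg 0)] with N hN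
      obtain ⟨p, α, hα, q, γ, hγ, hp, hq, h⟩ := hN
      rw [Fin.sum_univ_one] at hi
      have h1 : X.x 0 ^ N • f •
          exteriorPower.ιMulti X.R 1 (fun l => KaehlerDifferential.D K X.R (g l)) =
          (f * α) • u' + (f * γ) • e v := by
        have : exteriorPower.ιMulti X.R 1 (fun l => KaehlerDifferential.D K X.R (g l)) =
            e (KaehlerDifferential.D K X.R (g 0)) := by
          rw [LinearEquiv.eq_symm_apply, exteriorPower.oneEquiv_ιMulti]
        rw [this, smul_comm, ← map_smul e, h, map_add, map_smul, map_smul, smul_add, smul_smul,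
          smul_smul]
      rw [h1]
      refine Submodule.add_mem_sup (smul_mem_componentSmul _ ?_) (smul_mem_componentSmul _ ?_)
      · have := mul_mem_component hf hα
        rwa [show a + p = N + i - 1 by omega] at this
      · have := mul_mem_component hf hγ
        rwa [show a + q = N + i - k by omega] at this)
  have h1 := eventually_finrank_componentSmul_le hx₀ u' (1 : X.S) fun i c hc h => ⟨0, by
    rw [smul_eq_mul, mul_one] at h
    rw [eq_zero_of_algebraMap_S_eq_zero hx₀ hc h, zero_smul, smul_zero]⟩
  have h2 := eventually_finrank_componentSmul_le hx₀ (e v) ω₀ fun i c hc h => by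
    obtain ⟨N, hN⟩ := hv' i c hc h
    exact ⟨N, by rw [← map_smul e, ← map_smul e, hN, map_zero]⟩
  filter_upwards [h, eventually_ge_shift 1 h1, eventually_ge_shift k h2] with i hi h1 h2
  calc X.omegaHilbertFunction 1 i
      ≤ Module.finrank K
          (X.componentSmul (i - 1) u' ⊔ X.componentSmul (i - k) (e v) : Submodule K _) :=
        Submodule.finrank_mono hi
    _ ≤ _ := Submodule.finrank_add_le_finrank_add_finrank _ _
    _ ≤ _ := Nat.add_le_add h1.2 h2.2

theorem eventually_omegaHilbertFunction_two_le :
    ∀ᶠ i in atTop, X.omegaHilbertFunction 2 i ≤ Module.finrank K (Ω[X.S⁄K]) := by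
  obtain ⟨v, k, hv, hv'⟩ := exists_lift_generator X hω₀
  let u := KaehlerDifferential.D K X.R (X.x 0)
  let φ := exteriorPower.ιMulti X.R 2 (M := Ω[X.R⁄K])
  have h := eventually_omegaComponent_le hx₀ 2 (fun i => X.componentSmul (i - (k + 1)) (φ ![u, v]))
    (fun i a b f g hf hg hi => by
      obtain ⟨N₁, hN₁⟩ := (hv _ _ (hg 0)).exists
      -- The power `x_0^N` is split: a fixed `x_0^(N₁)` is absorbed by `dg_0` and the rest by
      -- `dg_1`.
      filter_upwards [eventually_ge_shift N₁ (hv _ _ (hg 1))] with N hN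
      obtain ⟨p, α, hα, q, γ, hγ, hp, hq, h⟩ := hN₁
      obtain ⟨hN, p', α', hα', q', γ', hγ', hp', hq', h'⟩ := hN
      rw [Fin.sum_univ_two] at hi
      have h1 : X.x 0 ^ N • f • φ (fun l => KaehlerDifferential.D K X.R (g l)) =
          (f * (α * γ' - α' * γ)) • φ ![u, v] := by
        have h2 : X.x 0 ^ N • φ (fun l => KaehlerDifferential.D K X.R (g l)) =
            φ ![X.x 0 ^ N₁ • KaehlerDifferential.D K X.R (g 0),
              X.x 0 ^ (N - N₁) • KaehlerDifferential.D K X.R (g 1)] := by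
          have h3 := φ.map_smul_univ ![X.x 0 ^ N₁, X.x 0 ^ (N - N₁)]
            (fun l => KaehlerDifferential.D K X.R (g l))
          rw [Fin.prod_univ_two, Matrix.cons_val_zero, Matrix.cons_val_one,
            Matrix.cons_val_fin_one, ← pow_add,
            Nat.add_sub_cancel' hN] at h3
          rw [← h3]
          congr 1
          ext l
          fin_cases l <;> rfl
        rw [smul_comm, h2, h, h', AlternatingMap.map_pair_combination, smul_smul]
      rw [h1]
      refine smul_mem_componentSmul _ ?_
      rw [show N + i - (k + 1) = a + (p + q') by omega]
      refine mul_mem_component hf (Submodule.sub_mem _ (mul_mem_component hα hγ') ?_)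
      rw [show p + q' = p' + q by omega]
      exact mul_mem_component hα' hγ)
  have h1 := eventually_finrank_componentSmul_le hx₀ (φ ![u, v]) ω₀ fun i c hc h => by
    obtain ⟨N, hN⟩ := hv' i c hc h
    refine ⟨N, ?_⟩
    -- Moving the scalar into the second slot gives `u ∧ (x_0^N c v)`, so whatever annihilates `v`
    -- annihilates `u ∧ v`.
    have h2 := AlternatingMap.map_pair_combination φ u v 1 0 0 (X.x 0 ^ N * c)
    rw [mul_smul, hN, one_mul, mul_zero, sub_zero, mul_smul] at h2
    rw [← h2]
    exact φ.map_coord_zero 1 (by simp)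
  filter_upwards [h, eventually_ge_shift (k + 1) h1] with i hi h1
  exact (Submodule.finrank_mono hi).trans h1.2

end UpperBounds

/-! ### The degree as `dim S`, and the conclusion -/

theorem hasHilbertPolynomial_degree (hx₀ : X.x 0 ∈ nonZeroDivisors X.R) :
    HasHilbertPolynomial X.hilbertFunction X.degree ∧ X.degree = Module.finrank K X.S := by
  have h0 : HasHilbertPolynomial X.hilbertFunction (Module.finrank K X.S) := by
    filter_upwards [eventually_finrank_component hx₀] with i hi
    exact congrArg Nat.cast hi
  have hex : ∃ c : ℤ, HasHilbertPolynomial X.hilbertFunction c := ⟨_, h0⟩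
  have h1 : HasHilbertPolynomial X.hilbertFunction X.degree := by
    rw [degree, dif_pos hex]
    exact hex.choose_spec
  obtain ⟨i, hi, hi'⟩ := (h0.and h1).exists
  exact ⟨h1, hi'.symm.trans hi⟩

end ZeroDimScheme

theorem mainTheorem6 {K : Type*} [Field K] [PerfectField K] {n : ℕ} (X : ZeroDimScheme K n)
    (hx₀ : X.x 0 ∈ nonZeroDivisors X.R) (hX : X.IsWeaklyCurvilinear) :
    Finite (MaximalSpectrum X.S) ∧
    HasHilbertPolynomial X.hilbertFunction X.degree ∧
    HasHilbertPolynomial (X.omegaHilbertFunction 1)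
      (2 * X.degree -
        ∑ᶠ (p : MaximalSpectrum X.S) (_ : ¬ ringChar K ∣ X.localLength p),
          (X.residueDegree p : ℤ)) ∧
    HasHilbertPolynomial (X.omegaHilbertFunction 2)
      (X.degree -
        ∑ᶠ (p : MaximalSpectrum X.S) (_ : ¬ ringChar K ∣ X.localLength p),
          (X.residueDegree p : ℤ)) ∧
    ∀ m : ℕ, 2 < m → HasHilbertPolynomial (X.omegaHilbertFunction m) 0 := by
  obtain ⟨⟨ω₀, hω₀⟩, hdim⟩ := kaehlerDifferential_of_isPrincipal_maximalIdeal K X.S hX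
  obtain ⟨hdeg, hdegS⟩ := ZeroDimScheme.hasHilbertPolynomial_degree hx₀
  have : IsArtinianRing X.S := IsArtinianRing.of_finite K X.S
  have hdim' : (Module.finrank K (Ω[X.S⁄K]) : ℤ) = X.degree -
      ∑ᶠ (p : MaximalSpectrum X.S) (_ : ¬ ringChar K ∣ X.localLength p),
        (X.residueDegree p : ℤ) := by
    rw [hdegS]
    exact hdim
  refine ⟨inferInstance, hdeg, ?_, ?_, fun m hm => ?_⟩
  · filter_upwards [X.eventually_le_omegaHilbertFunction_one,
      ZeroDimScheme.eventually_omegaHilbertFunction_one_le hx₀ hω₀] with i h1 h2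
    rw [two_mul, add_sub_assoc, ← hdim', hdegS]
    exact_mod_cast le_antisymm h2 h1
  · filter_upwards [X.eventually_le_omegaHilbertFunction_two,
      ZeroDimScheme.eventually_omegaHilbertFunction_two_le hx₀ hω₀] with i h1 h2
    rw [← hdim']
    exact_mod_cast le_antisymm h2 h1
  · filter_upwards [ZeroDimScheme.eventually_omegaHilbertFunction_eq_zero hx₀ hω₀ hm] with i hi
    exact_mod_cast hi
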